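/- Let $\Omega$ be a domain (a nonempty connected open set) in $\mathbb{C}^n$ and let $\mathcal{E}_1$ be a complex Hilbert space. Let $k_1,k_2:\Omega\times\Omega\to\mathbb{C}$ be positive semidefinite kernels that are analytic in the first variable, and put $K_1=k_1 I_{\mathcal{E}_1}$ and $K=k_2K_1=k_1k_2I_{\mathcal{E}_1}$. For a scalar or operator-valued kernel $L$ on $\Omega$ let $\mathcal{H}_L$ be its reproducing kernel Hilbert space, and for $L\in\{K_1,K\}$ let $\mathcal{M}(\mathcal{H}_L)$ be the set of multipliers of $\mathcal{H}_L$, that is, of all functions $\varphi:\Omega\to\mathcal{B}(\mathcal{E}_1)$ such that $\varphi f\in\mathcal{H}_L$ for every $f\in\mathcal{H}_L$; let $M_\varphi f=\varphi f$ be the corresponding bounded multiplication operator. Write $\lambda\sim_{k_1}\mu$ if there are $m\ge 1$ and $\lambda_1,\dots,\lambda_m\in\Omega$ with $\lambda_1=\lambda$, $\lambda_m=\mu$ and $k_1(\lambda_j,\lambda_{j+1})\neq 0$ for $1\le j\le m-1$; this is an equivalence relation. Suppose that (1) $\mathcal{M}(\mathcal{H}_{K_1})$ is the set of all uniformly bounded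 analytic functions $\Omega\to\mathcal{B}(\mathcal{E}_1)$, and $\|M_\varphi\|_{\mathcal{B}(\mathcal{H}_{K_1})}=\sup_{\lambda\in\Omega}\|\varphi(\lambda)\|$ for every $\varphi\in\mathcal{M}(\mathcal{H}_{K_1})$; (2) $\mathcal{H}_{k_1}\cap\mathcal{H}_{k_2}$ is dense in $\mathcal{H}_{k_1}$. Let $\varphi\in\mathcal{M}(\mathcal{H}_K)$ be an isometric multiplier, that is, let $M_\varphi$ be an isometry of $\mathcal{H}_K$. Then for every equivalence class $C$ of $\sim_{k_1}$ there is an isometry $V\in\mathcal{B}(\mathcal{E}_1)$ such that $\varphi(\lambda)=V$ for all $\lambda\in C$. -/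

import Mathlib

namespace KernelMultiplier

/-- The quasiscalar kernel `K(x, y) = k(x, y) I_E` on `X` attached to a scalar function `k`.
For `E = ℂ` this is the scalar kernel `k` itself, a number being read as an operator on `ℂ`. -/
def quasiscalar {X : Type*} (E : Type*) [NormedAddCommGroup E] [InnerProductSpace ℂ E]
    (k : X → X → ℂ) : Matrix X X (E →L[ℂ] E) :=
  Matrix.of fun x y => k x y • ContinuousLinearMap.id ℂ E

/-- The relation `∼_k`: `x` and `y` are joined by a finite chain along which `k` does not vanish
(the chain may consist of one point, so the relation is reflexive). -/
def KernelChain {X : Type*} (k : X → X → ℂ) : X → X → Prop :=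
  Relation.ReflTransGen fun x y => k x y ≠ 0

/-- Analyticity of a function that is defined only on the subset `Ω` (to be used for open `Ω`). -/
def IsAnalytic {n : ℕ} {Ω : Set (EuclideanSpace ℂ (Fin n))} {F : Type*} [NormedAddCommGroup F]
    [NormedSpace ℂ F] (f : Ω → F) : Prop :=
  ∃ g : EuclideanSpace ℂ (Fin n) → F, AnalyticOnNhd ℂ g Ω ∧ ∀ z : Ω, g z = f z

section Multipliers

variable {X E₁ E₂ : Type*} [NormedAddCommGroup E₁] [InnerProductSpace ℂ E₁]
  [NormedAddCommGroup E₂] [InnerProductSpace ℂ E₂]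
  (H₁ H₂ : Type*) [NormedAddCommGroup H₁] [InnerProductSpace ℂ H₁] [RKHS ℂ H₁ X E₁]
  [NormedAddCommGroup H₂] [InnerProductSpace ℂ H₂] [RKHS ℂ H₂ X E₂]

/-- `φ` is a multiplier from `H₁` to `H₂`: `φ f` belongs to `H₂` for every `f` in `H₁`. -/
def IsMultiplier (φ : X → E₁ →L[ℂ] E₂) : Prop :=
  ∀ f : H₁, ∃ g : H₂, ∀ x, g x = φ x (f x)

variable {H₁ H₂} {φ : X → E₁ →L[ℂ] E₂}

/-- The linear operator `f ↦ φ f`. -/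
noncomputable def mulLinear (h : IsMultiplier H₁ H₂ φ) : H₁ →ₗ[ℂ] H₂ where
  toFun f := (h f).choose
  map_add' f g := by
    ext x
    rw [(h (f + g)).choose_spec x]
    simp [(h f).choose_spec x, (h g).choose_spec x]
  map_smul' c f := by
    ext x
    rw [(h (c • f)).choose_spec x]
    simp [(h f).choose_spec x]

theorem mulLinear_apply (h : IsMultiplier H₁ H₂ φ) (f : H₁) (x : X) :
    mulLinear h f x = φ x (f x) :=
  (h f).choose_spec x

/-- The multiplication operator `M_φ : H₁ → H₂`, bounded by the closed graph theorem. -/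
noncomputable def mulOp [CompleteSpace H₁] [CompleteSpace H₂] (h : IsMultiplier H₁ H₂ φ) :
    H₁ →L[ℂ] H₂ :=
  ContinuousLinearMap.ofSeqClosedGraph (g := mulLinear h) (by
    intro u f g hu hg
    ext x
    have h1 := ((RKHS.continuous_eval (H := H₂) x).tendsto g).comp hg
    have h2 := ((φ x).continuous.tendsto _).comp
      (((RKHS.continuous_eval (H := H₁) x).tendsto f).comp hu)
    rw [mulLinear_apply]
    refine tendsto_nhds_unique h1 (h2.congr fun i => ?_)
    simp [mulLinear_apply])

theorem mulOp_apply [CompleteSpace H₁] [CompleteSpace H₂] (h : IsMultiplier H₁ H₂ φ)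
    (f : H₁) (x : X) : mulOp h f x = φ x (f x) :=
  mulLinear_apply h f x

end Multipliers

end KernelMultiplier

namespace KernelMultiplier

open Metric Set Filter Topology

/-! ### Banach-valued holomorphic functions of one variable -/

section OneVariable

/-! The proof carries `φ` over from `HK` to `HK₁` and then uses the tensor product `HK₁ ⊗ Hk₂`.
Unless `E₁ = 0`, the norm formula and density force `k₁` and `k₂` to be nonzero on the diagonal.
Pairing kernel functions with their images then gives `‖φ w‖ ≤ 1`, and dividing `M_φ K_w v` by `k(·,
w)` shows that `φ` is analytic (`IsMultiplier.isAnalytic`). So `φ` is a contractive multiplier of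
`HK₁`.

The core is `eq_of_kernel_ne_zero`. The map `K_w v ↦ K₁_w v ⊗ k₂_w` is isometric, and the closed
span of its image models restriction to the diagonal. With `Y = M_φ K₁_w v`, taken in `HK₁`, the
vector `Y ⊗ k₂_w` has the same pairings with this span as `M_φ K_w v` has with `HK`, and its norm is
no larger, because `M_φ` is isometric on `HK` and contractive on `HK₁`. Hence it lies in the closed
span and is orthogonal to every `fu ⊗ g - gu ⊗ f`, which vanishes on the diagonal. This gives `⟪Y,
fu⟫ g(w) = ⟪Y, gu⟫ f(w)` for `f`, `g` in the intersection, and by density on all of `Hk₁`. Kernel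
functions at `x` and `w` yield `φ x = φ w` whenever `k₁ w x ≠ 0`. Constancy follows along chains,
and isometry of the value from comparing norms of kernel functions.

Much of the file serves analyticity. The kernel is only separately analytic, so Hartogs' theorem is
needed to bound it on the diagonal; only then are norm limits of kernel combinations holomorphic. -/

theorem mapsTo_closedBall_of_norm_le {X F : Type*} [SeminormedAddCommGroup F] {f : X → F} {s : Set X} {M : ℝ} {c : X}
    (hc : c ∈ s) (hM : ∀ w ∈ s, ‖f w‖ ≤ M) : MapsTo f s (closedBall (f c) (2 * M)) := by
  intro w hw
  rw [mem_closedBall, dist_eq_norm]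
  linarith [norm_sub_le (f w) (f c), hM w hw, hM c hc]

variable {F : Type*} [NormedAddCommGroup F] [NormedSpace ℂ F]

/-- A first order Taylor estimate for bounded holomorphic functions. -/
theorem norm_dslope_sub_deriv_le [CompleteSpace F] {f : ℂ → F} {c z : ℂ} {r M : ℝ}
    (hf : DifferentiableOn ℂ f (ball c r)) (hM : ∀ w ∈ ball c r, ‖f w‖ ≤ M)
    (hz : z ∈ ball c r) : ‖dslope f c z - deriv f c‖ ≤ 4 * M / r ^ 2 * ‖z - c‖ := by
  have hr : 0 < r := nonempty_ball.mp ⟨z, hz⟩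
  have hcr : c ∈ ball c r := mem_ball_self hr
  -- The Schwarz lemma is used twice, for `f` and for `dslope f c`. Recentring the target disc costs
  -- a factor 2 each time, hence the 4.
  have h1 := mapsTo_closedBall_of_norm_le hcr hM
  have h2 : ∀ w ∈ ball c r, ‖dslope f c w‖ ≤ 2 * M / r := fun w hw =>
    Complex.norm_dslope_le_div_of_mapsTo_ball hf h1 hw
  have h3 := Complex.dist_le_div_mul_dist_of_mapsTo_ball
    ((Complex.differentiableOn_dslope (ball_mem_nhds c hr)).2 hf)
    (mapsTo_closedBall_of_norm_le hcr h2) hz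
  rw [dist_eq_norm, dist_eq_norm, dslope_same] at h3
  refine h3.trans (le_of_eq ?_)
  field_simp
  ring

/-- A locally bounded function into a Banach space is holomorphic as soon as its compositions with
a norming family of continuous linear maps are. -/
theorem differentiableAt_of_norming [CompleteSpace F] {ι G : Type*} [NormedAddCommGroup G]
    [NormedSpace ℂ G] [CompleteSpace G] (T : ι → F →L[ℂ] G)
    (hT : ∀ (x : F) (C : ℝ), 0 ≤ C → (∀ i, ‖T i x‖ ≤ C) → ‖x‖ ≤ C)
    {f : ℂ → F} {c : ℂ} {r M : ℝ} (hr : 0 < r) (hM0 : 0 ≤ M)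
    (hd : ∀ i, DifferentiableOn ℂ (fun z => T i (f z)) (ball c r))
    (hM : ∀ i, ∀ z ∈ ball c r, ‖T i (f z)‖ ≤ M) : DifferentiableAt ℂ f c := by
  set K : ℝ := 4 * M / r ^ 2 with hK
  have hK0 : 0 ≤ K := by positivity
  -- The Taylor constant is the same for all `T i`, so the norming property lifts the estimate to
  -- `F`: the slopes of `f` are Cauchy.
  have key : ∀ z ∈ ball c r, ∀ w ∈ ball c r, z ≠ c → w ≠ c →
      ‖slope f c z - slope f c w‖ ≤ K * ‖z - c‖ + K * ‖w - c‖ := by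
    intro z hz w hw hzc hwc
    refine hT _ _ (by positivity) fun i => ?_
    have e : ∀ u, u ≠ c → T i (slope f c u) = dslope (fun z => T i (f z)) c u := by
      intro u hu
      rw [dslope_of_ne _ hu, slope_def_module, slope_def_module, map_smul, map_sub]
    rw [map_sub, e z hzc, e w hwc]
    have h1 := norm_dslope_sub_deriv_le (hd i) (hM i) hz
    have h2 := norm_dslope_sub_deriv_le (hd i) (hM i) hw
    calc _ = ‖(dslope (fun z => T i (f z)) c z - deriv (fun z => T i (f z)) c) -
          (dslope (fun z => T i (f z)) c w - deriv (fun z => T i (f z)) c)‖ := by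
          rw [sub_sub_sub_cancel_right]
      _ ≤ _ := (norm_sub_le _ _).trans (add_le_add h1 h2)
  have hcau : Cauchy (map (slope f c) (𝓝[≠] c)) := by
    rw [Metric.cauchy_iff]
    refine ⟨inferInstance, fun ε hε => ?_⟩
    set δ := min r (ε / (2 * (K + 1))) with hδ
    have hδ0 : 0 < δ := by positivity
    refine ⟨slope f c '' (ball c δ ∩ {c}ᶜ), image_mem_map ?_, ?_⟩
    · rw [inter_comm]
      exact inter_mem_nhdsWithin _ (ball_mem_nhds c hδ0)
    rintro _ ⟨z, ⟨hz, hzc⟩, rfl⟩ _ ⟨w, ⟨hw, hwc⟩, rfl⟩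
    rw [dist_eq_norm]
    have hsub : ball c δ ⊆ ball c r := ball_subset_ball (min_le_left _ _)
    have h1 : ∀ u ∈ ball c δ, (K + 1) * ‖u - c‖ < ε / 2 := by
      intro u hu
      have : ‖u - c‖ < ε / (2 * (K + 1)) := by
        rw [← dist_eq_norm]
        exact lt_of_lt_of_le hu (min_le_right _ _)
      rw [lt_div_iff₀ (by positivity)] at this
      linarith
    have := key z (hsub hz) w (hsub hw) hzc hwc
    have a1 := h1 z hz
    have a2 := h1 w hw
    nlinarith [norm_nonneg (z - c), norm_nonneg (w - c)]
  obtain ⟨L, hL⟩ := CompleteSpace.complete hcau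
  exact (hasDerivAt_iff_tendsto_slope.2 hL).differentiableAt

/-- The partial derivative of a bounded separately holomorphic function is holomorphic in the other
variable. -/
theorem differentiableOn_deriv_of_separately [CompleteSpace F] {f : ℂ → ℂ → F} {U : Set ℂ}
    (hU : IsOpen U) {c : ℂ} {r M : ℝ} (hr : 0 < r)
    (h1 : ∀ w ∈ ball c r, DifferentiableOn ℂ (fun z => f z w) U)
    (h2 : ∀ z ∈ U, DifferentiableOn ℂ (f z) (ball c r))
    (hM : ∀ z ∈ U, ∀ w ∈ ball c r, ‖f z w‖ ≤ M) :
    DifferentiableOn ℂ (fun z => deriv (f z) c) U := by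
  have hb : ball c r ∈ 𝓝[≠] c := mem_nhdsWithin_of_mem_nhds (ball_mem_nhds c hr)
  -- The Taylor error is uniform in `z`, so the derivative is a uniform limit of functions
  -- holomorphic in `z`.
  have hlim : TendstoUniformlyOn (fun w z => slope (f z) c w) (fun z => deriv (f z) c)
      (𝓝[≠] c) U := by
    rw [Metric.tendstoUniformlyOn_iff]
    intro ε hε
    have ht : Tendsto (fun w : ℂ => 4 * M / r ^ 2 * ‖w - c‖) (𝓝[≠] c) (𝓝 0) := by
      have : Continuous fun w : ℂ => 4 * M / r ^ 2 * ‖w - c‖ := by fun_prop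
      simpa using (this.tendsto c).mono_left nhdsWithin_le_nhds
    filter_upwards [ht.eventually (gt_mem_nhds hε), hb, self_mem_nhdsWithin] with w hw hwb hwc z hz
    rw [dist_comm, dist_eq_norm, ← dslope_of_ne _ hwc]
    exact (norm_dslope_sub_deriv_le (h2 z hz) (hM z hz) hwb).trans_lt hw
  refine hlim.tendstoLocallyUniformlyOn.differentiableOn ?_ hU
  filter_upwards [hb] with w hw
  simp only [slope_def_module]
  exact ((h1 w hw).sub (h1 c (mem_ball_self hr))).const_smul _

/-- Induction replaces `f` by its derivative in the second variable; Cauchy's estimate bounds it on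
half the radius. -/
theorem differentiableOn_iteratedDeriv_of_separately [CompleteSpace F] (n : ℕ) {f : ℂ → ℂ → F}
    {U : Set ℂ} (hU : IsOpen U) {c : ℂ} {r M : ℝ} (hr : 0 < r)
    (h1 : ∀ w ∈ ball c r, DifferentiableOn ℂ (fun z => f z w) U)
    (h2 : ∀ z ∈ U, DifferentiableOn ℂ (f z) (ball c r))
    (hM : ∀ z ∈ U, ∀ w ∈ ball c r, ‖f z w‖ ≤ M) :
    DifferentiableOn ℂ (fun z => iteratedDeriv n (f z) c) U := by
  induction n generalizing f r M with
  | zero => simpa using h1 c (mem_ball_self hr)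
  | succ n ih =>
    simp only [iteratedDeriv_succ']
    have hsub : ∀ w ∈ ball c (r / 2), ball w (r / 2) ⊆ ball c r := fun w hw =>
      ball_subset_ball' (by rw [mem_ball] at hw; linarith)
    refine ih (f := fun z => deriv (f z)) (half_pos hr) (M := 2 * M / (r / 2))
      (fun w hw => ?_) (fun z hz => ?_) fun z hz w hw => ?_
    · exact differentiableOn_deriv_of_separately hU (half_pos hr) (fun w' hw' => h1 w' (hsub w hw hw'))
        (fun z hz => (h2 z hz).mono (hsub w hw)) fun z hz w' hw' => hM z hz w' (hsub w hw hw')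
    · exact ((h2 z hz).deriv isOpen_ball).mono (ball_subset_ball (by linarith))
    · exact Complex.norm_deriv_le_div_of_mapsTo_ball ((h2 z hz).mono (hsub w hw))
        (mapsTo_closedBall_of_norm_le (mem_ball_self (half_pos hr))
          fun w' hw' => hM z hz w' (hsub w hw hw')) (half_pos hr)

end OneVariable

/-! ### Jensen's formula and a two constants estimate -/

section SubMean

open MeasureTheory Real

/-- The sub-mean value property of `log ‖g‖` on circles. -/
theorem log_norm_le_circleAverage {g : ℂ → ℂ} {c : ℂ} {t : ℝ} (ht : 0 < t)
    (hg : AnalyticOnNhd ℂ g (closedBall c |t|)) (hgc : g c ≠ 0) :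
    log ‖g c‖ ≤ circleAverage (fun z => log ‖g z‖) c t := by
  -- By Jensen's formula the gap is a sum over the zeros `u` in the disc, with nonnegative terms:
  -- multiplicity times `log (t / ‖c - u‖)`.
  rw [hg.circleAverage_log_norm ht.ne' hgc]
  refine le_add_of_nonneg_left (finsum_nonneg fun u => ?_)
  by_cases hu : u ∈ closedBall c |t|
  · refine mul_nonneg (mod_cast MeromorphicOn.AnalyticOnNhd.divisor_nonneg hg u) ?_
    rcases eq_or_ne c u with rfl | h
    · simp
    · refine log_nonneg ?_
      have h0 : 0 < ‖c - u‖ := norm_pos_iff.2 (sub_ne_zero.2 h)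
      rw [mem_closedBall, dist_eq_norm', abs_of_pos ht] at hu
      rw [← div_eq_mul_inv, le_div_iff₀ h0]
      simpa using hu
  · rw [Function.locallyFinsuppWithin.apply_eq_zero_of_notMem _ hu]
    simp

theorem circleAverage_eq_integral_neg_pi_pi (f : ℂ → ℝ) (c : ℂ) (t : ℝ) :
    circleAverage f c t = (2 * π)⁻¹ * ∫ θ in Ioo (-π) π, f (circleMap c t θ) := by
  rw [circleAverage_eq_integral_add (-π),
    intervalIntegral.integral_comp_add_right (fun θ => f (circleMap c t θ)),
    intervalIntegral.integral_of_le (by linarith [pi_pos]), integral_Ioc_eq_integral_Ioo,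
    smul_eq_mul]
  congr 3
  all_goals ring_nf

/-- If `‖g‖ ≤ exp a` off a set `B` and `‖g‖ ≤ exp (a + b)` everywhere, then on every circle around
`c` the set `B` takes up at least a fixed proportion. -/
theorem le_measure_circle_of_log_norm {g : ℂ → ℂ} {c : ℂ} {t a b : ℝ} (ht : 0 < t) (ha : 0 ≤ a)
    (hb : 0 < b) (hg : AnalyticOnNhd ℂ g (closedBall c |t|)) (hgc : g c ≠ 0) {B : Set ℂ}
    (hB : MeasurableSet B) (h1 : ∀ w ∈ closedBall c t, w ∉ B → ‖g w‖ ≤ exp a)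
    (h2 : ∀ w ∈ closedBall c t, ‖g w‖ ≤ exp (a + b)) :
    ENNReal.ofReal (2 * π * ((log ‖g c‖ - a) / b)) ≤
      ∫⁻ θ in Ioo (-π) π, B.indicator 1 (circleMap c t θ) := by
  -- `Real.log 0 = 0` instead of `-∞`, so at zeros of `g` the bound needs `0 ≤ C`.
  have hlog : ∀ w, ∀ C, 0 ≤ C → ‖g w‖ ≤ exp C → log ‖g w‖ ≤ C := by
    intro w C hC h
    rcases eq_or_ne (g w) 0 with h0 | h0
    · simpa [h0] using hC
    · exact (log_le_iff_le_exp (norm_pos_iff.2 h0)).2 h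
  have hmeas : Measurable (circleMap c t) := (continuous_circleMap c t).measurable
  set S : Set ℝ := circleMap c t ⁻¹' B with hS
  have hSm : MeasurableSet S := hmeas hB
  set μ := (volume : Measure ℝ).restrict (Ioo (-π) π) with hμ
  have hind : ∀ θ, (B.indicator 1 (circleMap c t θ) : ENNReal) = S.indicator 1 θ :=
    fun _ => rfl
  simp only [hind]
  rw [lintegral_indicator_one hSm]
  refine ENNReal.ofReal_le_of_le_toReal ?_
  change _ ≤ μ.real S
  have hint : IntegrableOn (fun θ => log ‖g (circleMap c t θ)‖) (Ioo (-π) π) := by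
    have hper : Function.Periodic (fun θ => log ‖g (circleMap c t θ)‖) (2 * π) := fun θ => by
      simp only [periodic_circleMap c t θ]
    have h0 : CircleIntegrable (fun z => log ‖g z‖) c t :=
      (hg.mono sphere_subset_closedBall).meromorphicOn.circleIntegrable_log_norm
    have h3 : IntervalIntegrable (fun θ => log ‖g (circleMap c t θ)‖) volume (-π) (-π + 2 * π) :=
      hper.intervalIntegrable (t := 0) (by positivity) (by simpa [CircleIntegrable] using h0) _ _
    rw [intervalIntegrable_iff_integrableOn_Ioo_of_le (by linarith [pi_pos])] at h3
    rwa [show -π + 2 * π = π by ring] at h3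
  have hi : Integrable (S.indicator (1 : ℝ → ℝ)) μ := (integrable_const (1 : ℝ)).indicator hSm
  have hint2 : IntegrableOn (fun θ => a + b * S.indicator 1 θ) (Ioo (-π) π) := by
    exact (integrable_const a).add (hi.const_mul b)
  have hle : ∫ θ in Ioo (-π) π, log ‖g (circleMap c t θ)‖ ≤
      ∫ θ in Ioo (-π) π, (a + b * S.indicator 1 θ) := by
    refine integral_mono hint hint2 fun θ => ?_
    have hm : circleMap c t θ ∈ closedBall c t :=
      sphere_subset_closedBall (circleMap_mem_sphere c ht.le θ)
    by_cases hθ : θ ∈ S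
    · simpa [hθ] using hlog _ _ (by linarith) (h2 _ hm)
    · simpa [hθ] using hlog _ _ ha (h1 _ hm hθ)
  have hval : ∫ θ in Ioo (-π) π, (a + b * S.indicator 1 θ) = 2 * π * a + b * μ.real S := by
    rw [integral_add (integrable_const a) (hi.const_mul b), integral_const_mul,
      integral_indicator_one hSm]
    simp only [integral_const, smul_eq_mul, measureReal_restrict_apply_univ, Real.volume_real_Ioo,
      sub_neg_eq_add, hμ]
    rw [max_eq_left (by linarith [pi_pos])]
    ring
  have hsub := log_norm_le_circleAverage ht hg hgc
  rw [circleAverage_eq_integral_neg_pi_pi, inv_mul_eq_div, le_div_iff₀ (by positivity)] at hsub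
  have : (log ‖g c‖ - a) / b * (2 * π) ≤ μ.real S := by
    rw [div_mul_eq_mul_div, div_le_iff₀ hb]
    linarith
  linarith

/-- Integration in polar coordinates around an arbitrary point. -/
theorem volume_eq_lintegral_circleMap (c : ℂ) {B : Set ℂ} (hB : MeasurableSet B) :
    volume B = ∫⁻ t in Ioi (0 : ℝ), ENNReal.ofReal t *
      ∫⁻ θ in Ioo (-π) π, B.indicator 1 (circleMap c t θ) := by
  have hmeas : Measurable fun p : ℝ × ℝ => (B.indicator 1 (circleMap c p.1 p.2) : ENNReal) := by
    have h1 : Measurable fun p : ℝ × ℝ => circleMap c p.1 p.2 := by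
      unfold circleMap
      fun_prop
    exact (measurable_one.indicator hB).comp h1
  rw [← lintegral_indicator_one hB, ← lintegral_add_left_eq_self _ c,
    ← Complex.lintegral_comp_polarCoord_symm, polarCoord_target, Measure.volume_eq_prod,
    ← Measure.prod_restrict, lintegral_prod]
  · refine lintegral_congr fun t => ?_
    rw [← lintegral_const_mul]
    · refine lintegral_congr fun θ => ?_
      simp [circleMap, Complex.exp_mul_I]
    · exact hmeas.comp (measurable_const.prodMk measurable_id)
  · have : (fun p : ℝ × ℝ => ENNReal.ofReal p.1 • (B.indicator 1 (c + Complex.polarCoord.symm p) :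
        ENNReal)) = fun p => ENNReal.ofReal p.1 * B.indicator 1 (circleMap c p.1 p.2) := by
      funext p
      simp [circleMap, Complex.exp_mul_I]
    rw [this]
    exact (measurable_fst.ennreal_ofReal.mul hmeas).aemeasurable

/-- A two constants estimate: if `‖g‖ ≤ exp (a + b)` on a disc of radius `r` around `c`, and
`‖g‖ ≤ exp a` there off a set whose measure is at most `η` times the measure of the disc, then
`‖g c‖ ≤ exp (a + η b)`. -/
theorem norm_le_exp_of_volume_le {g : ℂ → ℂ} {c : ℂ} {r a b η : ℝ} (hr : 0 < r) (ha : 0 ≤ a)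
    (hb : 0 ≤ b) (hη : 0 ≤ η) (hg : AnalyticOnNhd ℂ g (closedBall c r)) {B : Set ℂ}
    (hB : MeasurableSet B) (h1 : ∀ w ∈ closedBall c r, w ∉ B → ‖g w‖ ≤ exp a)
    (h2 : ∀ w ∈ closedBall c r, ‖g w‖ ≤ exp (a + b))
    (hvol : volume B ≤ ENNReal.ofReal (η * (π * r ^ 2))) : ‖g c‖ ≤ exp (a + η * b) := by
  rcases hb.eq_or_lt with rfl | hb
  · simpa using h2 c (mem_closedBall_self hr.le)
  -- Otherwise `B` occupies at least a proportion `η' > η` of every circle around `c`, and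
  -- integrating over the radii contradicts `hvol`.
  by_contra! hcon
  have hgc : g c ≠ 0 := norm_pos_iff.1 ((exp_pos _).trans hcon)
  set η' := (log ‖g c‖ - a) / b with hη'
  have hηη : η < η' := by
    rw [hη', lt_div_iff₀ hb]
    have := (lt_log_iff_exp_lt (norm_pos_iff.2 hgc)).2 hcon
    linarith
  have hlow : ENNReal.ofReal (η' * (π * r ^ 2)) ≤ volume B := by
    rw [volume_eq_lintegral_circleMap c hB]
    calc ENNReal.ofReal (η' * (π * r ^ 2))
        = ∫⁻ t in Ioc 0 r, ENNReal.ofReal (t * (2 * π * η')) := by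
          rw [← ofReal_integral_eq_lintegral_ofReal]
          · rw [← intervalIntegral.integral_of_le hr.le, intervalIntegral.integral_mul_const,
              integral_id]
            congr 1
            ring
          · exact (by fun_prop : Continuous fun t : ℝ => t * (2 * π * η')).integrableOn_Ioc
          · filter_upwards [ae_restrict_mem measurableSet_Ioc] with t ht
            have := hη.trans_lt hηη
            have := ht.1
            positivity
      _ ≤ ∫⁻ t in Ioc 0 r, ENNReal.ofReal t *
            ∫⁻ θ in Ioo (-π) π, B.indicator 1 (circleMap c t θ) := by
          refine setLIntegral_mono' measurableSet_Ioc fun t ht => ?_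
          rw [ENNReal.ofReal_mul ht.1.le]
          have hsub : closedBall c t ⊆ closedBall c r := closedBall_subset_closedBall ht.2
          gcongr
          exact le_measure_circle_of_log_norm ht.1 ha hb
            (hg.mono (by rwa [abs_of_pos ht.1])) hgc hB (fun w hw => h1 w (hsub hw))
            fun w hw => h2 w (hsub hw)
      _ ≤ _ := lintegral_mono_set Ioc_subset_Ioi_self
  have h3 := hlow.trans hvol
  rw [ENNReal.ofReal_le_ofReal_iff (by positivity)] at h3
  have : 0 < π * r ^ 2 := by positivity
  exact absurd (le_of_mul_le_mul_right h3 this) (not_le.2 hηη)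

end SubMean

/-! ### Hartogs' theorem in two variables -/

section Hartogs

open MeasureTheory Real

/-- A separately holomorphic function is bounded on the product of a given disc in the first
variable and some small disc in the second variable. -/
theorem exists_bounded_of_separately {f : ℂ → ℂ → ℂ} {R ρ ε : ℝ} (hε : 0 < ε) (hεR : ε < R)
    (hρR : ρ < R) (h1 : ∀ w ∈ ball 0 R, DifferentiableOn ℂ (fun z => f z w) (ball 0 R))
    (h2 : ∀ z ∈ ball 0 R, DifferentiableOn ℂ (f z) (ball 0 R)) :
    ∃ w₀ : ℂ, ∃ s M : ℝ, 0 < s ∧ ball w₀ s ⊆ ball 0 ε ∧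
      ∀ z ∈ closedBall 0 ρ, ∀ w ∈ ball w₀ s, ‖f z w‖ ≤ M := by
  have hsubε : closedBall (0 : ℂ) ε ⊆ ball 0 R := closedBall_subset_ball hεR
  have hsubρ : closedBall (0 : ℂ) ρ ⊆ ball 0 R := closedBall_subset_ball hρR
  set A : ℕ → Set ℂ := fun N => closedBall 0 ε ∩
    ⋂ z ∈ closedBall (0 : ℂ) ρ, closedBall 0 ε ∩ f z ⁻¹' closedBall 0 N with hA
  have hAc : ∀ N, IsClosed (A N) := fun N => by
    refine isClosed_closedBall.inter (isClosed_biInter fun z hz => ?_)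
    exact ((h2 z (hsubρ hz)).continuousOn.mono hsubε).preimage_isClosed_of_isClosed
      isClosed_closedBall isClosed_closedBall
  -- Adding the closed complement of the disc makes the sets cover the plane, so that Baire's
  -- theorem applies there.
  have hcov : (univ : Set ℂ) ⊆ ⋃ N, (A N ∪ (ball 0 ε)ᶜ) := by
    intro w _
    by_cases hw : w ∈ ball (0 : ℂ) ε
    · have hwc := ball_subset_closedBall hw
      obtain ⟨C, hC⟩ := (isCompact_closedBall (0 : ℂ) ρ).exists_bound_of_continuousOn
        ((h1 w (hsubε hwc)).continuousOn.mono hsubρ)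
      obtain ⟨N, hN⟩ := exists_nat_ge C
      refine mem_iUnion.2 ⟨N, Or.inl ⟨hwc, mem_iInter₂.2 fun z hz => ⟨hwc, ?_⟩⟩⟩
      simpa using (hC z hz).trans hN
    · exact mem_iUnion.2 ⟨0, Or.inr hw⟩
  have hdense := IsGδ.univ.dense_iUnion_interior_of_closed dense_univ
    (fun N => (hAc N).union isOpen_ball.isClosed_compl) hcov
  obtain ⟨w₀, hw₀, hw₁⟩ := hdense.inter_open_nonempty (ball 0 ε) isOpen_ball
    ⟨0, mem_ball_self hε⟩
  obtain ⟨N, hN⟩ := mem_iUnion.1 hw₁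
  obtain ⟨s, hs, hsub⟩ := Metric.isOpen_iff.1 (isOpen_interior.inter isOpen_ball) w₀ ⟨hN, hw₀⟩
  refine ⟨w₀, s, N, hs, fun w hw => (hsub hw).2, fun z hz w hw => ?_⟩
  rcases interior_subset (hsub hw).1 with h | h
  · simpa using (mem_iInter₂.1 h.2 z hz).2
  · exact absurd (hsub hw).2 h

/-- A sequence of holomorphic functions that is pointwise bounded and grows at most exponentially
grows, on a smaller disc, more slowly than any given exponential. -/
theorem exists_uniform_growth {G : ℕ → ℂ → ℂ} {r M q κ : ℝ} (hr : 0 < r) (hM : 1 ≤ M)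
    (hq : 1 ≤ q) (hκ : 1 < κ) (hG : ∀ n, DifferentiableOn ℂ (G n) (ball 0 (4 * r)))
    (hb : ∀ n, ∀ z ∈ ball 0 (4 * r), ‖G n z‖ ≤ M * q ^ n)
    (hp : ∀ z ∈ ball 0 (4 * r), ∃ C : ℝ, ∀ n, ‖G n z‖ ≤ C) :
    ∃ C : ℝ, ∀ n, ∀ z ∈ ball 0 r, ‖G n z‖ ≤ C * κ ^ n := by
  have hsub : closedBall (0 : ℂ) (2 * r) ⊆ ball 0 (4 * r) := closedBall_subset_ball (by linarith)
  -- `B N` is where some `‖G n z‖` exceeds `N`. Pointwise boundedness makes these sets shrink to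
  -- `∅`, so their measure tends to 0.
  set B : ℕ → Set ℂ := fun N => closedBall 0 (2 * r) \
    ⋂ n, closedBall 0 (2 * r) ∩ G n ⁻¹' closedBall 0 N with hB
  have hBm : ∀ N, MeasurableSet (B N) := fun N => by
    refine measurableSet_closedBall.diff (isClosed_iInter fun n => ?_).measurableSet
    exact ((hG n).continuousOn.mono hsub).preimage_isClosed_of_isClosed
      isClosed_closedBall isClosed_closedBall
  have hanti : Antitone B := by
    intro N N' hNN
    refine sdiff_subset_sdiff_right (iInter_mono fun n => inter_subset_inter_right _
      (preimage_mono (closedBall_subset_closedBall (by exact_mod_cast hNN))))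
  have hempty : ⋂ N, B N = ∅ := by
    rw [eq_empty_iff_forall_notMem]
    intro z hz
    rw [mem_iInter] at hz
    have hz0 := (hz 0).1
    obtain ⟨C, hC⟩ := hp z (hsub hz0)
    obtain ⟨N, hN⟩ := exists_nat_ge C
    exact (hz N).2 (mem_iInter.2 fun n => ⟨hz0, by simpa using (hC n).trans hN⟩)
  have htend := tendsto_measure_iInter_atTop (μ := (volume : Measure ℂ))
    (fun N => (hBm N).nullMeasurableSet) hanti
    ⟨0, ((measure_mono sdiff_subset).trans_lt measure_closedBall_lt_top).ne⟩
  rw [hempty, measure_empty] at htend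
  -- Chosen so that `η log q ≤ log κ`, with `η ≤ 1` to keep the factor `M`. The `1 +` prevents
  -- division by zero when `q = 1`.
  set η := min 1 (log κ / (1 + log q)) with hη
  have hlogq : 0 ≤ log q := log_nonneg hq
  have hη0 : 0 < η := lt_min one_pos (div_pos (log_pos hκ) (by linarith))
  have hηq : η * log q ≤ log κ := by
    have h1 : η * (1 + log q) ≤ log κ :=
      (le_div_iff₀ (by linarith)).1 (min_le_right _ _)
    nlinarith
  obtain ⟨N, hN, hN1⟩ := ((htend.eventually (gt_mem_nhds (ENNReal.ofReal_pos.2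
    (by positivity : 0 < η * (π * r ^ 2))))).and (eventually_ge_atTop 1)).exists
  have hN1' : (1 : ℝ) ≤ N := by exact_mod_cast hN1
  refine ⟨N * M, fun n c hc => ?_⟩
  have hcsub : closedBall c r ⊆ closedBall 0 (2 * r) :=
    closedBall_subset_closedBall' (by rw [mem_ball] at hc; linarith)
  have hM0 : 0 < M := by linarith
  have hq0 : 0 < q := by linarith
  have hN0 : (0 : ℝ) < N := by linarith
  have hlogM : 0 ≤ log M := log_nonneg hM
  have hexp : exp (log N + (log M + n * log q)) = N * (M * q ^ n) := by
    rw [exp_add, exp_add, exp_log hN0, exp_log hM0, exp_nat_mul, exp_log hq0]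
  have hmain := norm_le_exp_of_volume_le (g := G n) (c := c) (B := B N) (a := log N)
    (b := log M + n * log q) hr (log_nonneg hN1') (by positivity) hη0.le
    ((((hG n).analyticOnNhd isOpen_ball)).mono (hcsub.trans hsub)) (hBm N)
    (fun w hw hwB => by
      have : w ∈ ⋂ n, closedBall 0 (2 * r) ∩ G n ⁻¹' closedBall 0 N := by
        by_contra h
        exact hwB ⟨hcsub hw, h⟩
      rw [exp_log hN0]
      simpa using (mem_iInter.1 this n).2)
    (fun w hw => by
      rw [hexp]
      have h1 := hb n w (hsub (hcsub hw))
      have h2 : 0 ≤ M * q ^ n := by positivity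
      nlinarith) hN.le
  refine hmain.trans ?_
  have h3 : log N + η * (log M + n * log q) ≤ log N + (log M + n * log κ) := by
    have h4 : η * log M ≤ log M := mul_le_of_le_one_left hlogM (min_le_left _ _)
    have h5 : (n : ℝ) * (η * log q) ≤ n * log κ := by gcongr
    nlinarith
  refine (exp_le_exp.2 h3).trans (le_of_eq ?_)
  rw [exp_add, exp_add, exp_log hN0, exp_log hM0, exp_nat_mul, exp_log (by linarith), mul_assoc]

/-- **Hartogs' theorem** in two variables: separately holomorphic functions are locally bounded. -/
theorem exists_bounded_nhds_of_separately {f : ℂ → ℂ → ℂ} {R : ℝ} (hR : 0 < R)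
    (h1 : ∀ w ∈ ball 0 R, DifferentiableOn ℂ (fun z => f z w) (ball 0 R))
    (h2 : ∀ z ∈ ball 0 R, DifferentiableOn ℂ (f z) (ball 0 R)) :
    ∃ r C : ℝ, 0 < r ∧ ∀ z ∈ ball 0 r, ∀ w ∈ ball 0 r, ‖f z w‖ ≤ C := by
  obtain ⟨w₀, s, M₀, hs, hsub, hM₀⟩ := exists_bounded_of_separately (ε := R / 8) (ρ := R / 2)
    (by linarith) (by linarith) (by linarith) h1 h2
  set M := max M₀ 1 with hM
  have hw₀ : ‖w₀‖ < R / 8 := by simpa using hsub (mem_ball_self hs)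
  have hsR : s ≤ R := by
    by_contra! h
    have : w₀ + (R / 2 : ℝ) ∈ ball w₀ s := by
      simp [abs_of_pos hR]
      linarith
    have h4 := hsub this
    rw [mem_ball_zero_iff] at h4
    have h5 := norm_sub_le (w₀ + (R / 2 : ℝ)) w₀
    rw [add_sub_cancel_left, Complex.norm_real, norm_eq_abs, abs_of_pos (by linarith)] at h5
    linarith
  have hU : ball (0 : ℂ) (4 * (R / 8)) ⊆ ball 0 R := ball_subset_ball (by linarith)
  have hU' : ball (0 : ℂ) (4 * (R / 8)) ⊆ closedBall 0 (R / 2) :=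
    ball_subset_closedBall.trans (closedBall_subset_closedBall (by linarith))
  have hsR' : ball w₀ s ⊆ ball 0 R := hsub.trans (ball_subset_ball (by linarith))
  have hcR : closedBall w₀ (R / 2) ⊆ ball 0 R := by
    refine closedBall_subset_ball' ?_
    rw [dist_zero_right]
    linarith
  -- Taylor coefficients at `w₀`, scaled by `(R / 2) ^ n`: Cauchy's estimate on radius `R / 2`
  -- bounds them pointwise in `z`, and on radius `s / 2` uniformly by `M * (R / s) ^ n`.
  set G : ℕ → ℂ → ℂ := fun n z => ((R / 2 : ℝ) ^ n / n.factorial : ℂ) * iteratedDeriv n (f z) w₀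
    with hG
  have hGnorm : ∀ n z, ‖G n z‖ = (R / 2) ^ n / n.factorial * ‖iteratedDeriv n (f z) w₀‖ := by
    intro n z
    have h3 : ‖((R / 2 : ℝ) : ℂ)‖ = R / 2 := by
      rw [Complex.norm_real, norm_eq_abs, abs_of_pos (half_pos hR)]
    rw [hG]
    simp only
    rw [norm_mul, norm_div, norm_pow, h3, Complex.norm_natCast]
  have hGle : ∀ n z C ρ, 0 < ρ → closedBall w₀ ρ ⊆ ball 0 R → z ∈ ball (0 : ℂ) R →
      (∀ w ∈ closedBall w₀ ρ, ‖f z w‖ ≤ C) → ‖G n z‖ ≤ C * (R / 2 / ρ) ^ n := by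
    intro n z C ρ hρ hsubρ hz hC
    have := Complex.norm_iteratedDeriv_le_of_forall_mem_sphere_norm_le n hρ
      ((h2 z hz).mono ((closure_ball_subset_closedBall).trans hsubρ)).diffContOnCl
      fun w hw => hC w (sphere_subset_closedBall hw)
    rw [hGnorm]
    calc _ ≤ (R / 2) ^ n / n.factorial * (n.factorial * C / ρ ^ n) := by gcongr
      _ = _ := by
        rw [div_pow (R / 2) ρ]
        field_simp
  -- Below `‖w - w₀‖ / (R / 2) ≤ 1 / 2`, so any `κ < 2` works; `4 / 3` gives the ratio `2 / 3`.
  obtain ⟨C, hC⟩ := exists_uniform_growth (G := G) (r := R / 8) (M := M) (q := R / s) (κ := 4 / 3)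
    (by linarith) (le_max_right _ _) ((one_le_div hs).2 hsR) (by norm_num)
    (fun n => (differentiableOn_iteratedDeriv_of_separately n isOpen_ball hs
      (fun w hw => (h1 w (hsR' hw)).mono hU) (fun z hz => (h2 z (hU hz)).mono hsR')
      fun z hz w hw => hM₀ z (hU' hz) w hw).const_mul _)
    (fun n z hz => by
      have hss : closedBall w₀ (s / 2) ⊆ ball w₀ s := closedBall_subset_ball (by linarith)
      have := hGle n z M (s / 2) (by linarith) (hss.trans hsR') (hU hz)
        fun w hw => (hM₀ z (hU' hz) w (hss hw)).trans (le_max_left _ _)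
      rwa [div_div_div_cancel_right₀ two_ne_zero] at this)
    (fun z hz => by
      obtain ⟨C, hC⟩ := (isCompact_closedBall w₀ (R / 2)).exists_bound_of_continuousOn
        ((h2 z (hU hz)).continuousOn.mono hcR)
      refine ⟨C, fun n => ?_⟩
      simpa [div_self (half_pos hR).ne'] using
        hGle n z C (R / 2) (half_pos hR) hcR (hU hz) hC)
  have hC0 : 0 ≤ C := by
    have := hC 0 0 (mem_ball_self (by linarith))
    simpa using (norm_nonneg _).trans this
  refine ⟨R / 8, C * (1 - 2 / 3)⁻¹, by linarith, fun z hz w hw => ?_⟩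
  have hzR : z ∈ ball (0 : ℂ) R := ball_subset_ball (by linarith) hz
  have hww : ‖w - w₀‖ < R / 4 := by
    rw [mem_ball_zero_iff] at hw
    linarith [norm_sub_le w w₀]
  have hsum := Complex.hasSum_taylorSeries_on_ball (f := f z) (c := w₀) (r := R / 2)
    ((h2 z hzR).mono (ball_subset_closedBall.trans hcR)) (z := w)
    (by rw [mem_ball, dist_eq_norm]; linarith)
  rw [← hsum.tsum_eq]
  refine tsum_of_norm_bounded ((hasSum_geometric_of_lt_one (by norm_num : (0 : ℝ) ≤ 2 / 3)
    (by norm_num)).mul_left C) fun n => ?_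
  have hn := hC n z hz
  rw [hGnorm] at hn
  have hR2 : ‖w - w₀‖ / (R / 2) ≤ 1 / 2 := by
    rw [div_le_iff₀ (half_pos hR)]
    linarith
  calc _ = (R / 2) ^ n / n.factorial * ‖iteratedDeriv n (f z) w₀‖ * (‖w - w₀‖ / (R / 2)) ^ n := by
        simp only [norm_smul, norm_inv, Complex.norm_natCast, norm_pow, div_pow]
        field_simp
    _ ≤ C * (4 / 3) ^ n * (1 / 2) ^ n := by
        gcongr
    _ = C * (2 / 3) ^ n := by
        rw [mul_assoc, ← mul_pow]
        norm_num

end Hartogs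

/-! ### From holomorphy along lines to analyticity -/

section Gateaux

variable {E F : Type*} [NormedAddCommGroup E] [NormedSpace ℂ E] [NormedAddCommGroup F]
  [NormedSpace ℂ F]

theorem differentiableAt_comp_line {f : E → F} {x v : E} {ζ : ℂ}
    (h : LineDifferentiableAt ℂ f (x + ζ • v) v) :
    DifferentiableAt ℂ (fun ξ : ℂ => f (x + ξ • v)) ζ := by
  have h1 : DifferentiableAt ℂ (fun t : ℂ => f (x + ζ • v + t • v)) (ζ - ζ) := by
    rw [sub_self]
    exact h
  have h2 : DifferentiableAt ℂ (fun ξ : ℂ => ξ - ζ) ζ := by fun_prop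
  refine (DifferentiableAt.comp (g := fun t : ℂ => f (x + ζ • v + t • v)) (f := fun ξ => ξ - ζ) ζ h1 h2
    ).congr_of_eventuallyEq (Eventually.of_forall fun ξ => ?_)
  simp only [Function.comp_apply]
  rw [add_assoc, ← add_smul, add_sub_cancel]

theorem add_mem_ball_of_norm_lt {E : Type*} [SeminormedAddCommGroup E] {x y v : E} {R ρ : ℝ} (hy : y ∈ ball x (R - ρ)) (hv : ‖v‖ < ρ) :
    y + v ∈ ball x R := by
  rw [mem_ball, dist_eq_norm] at hy ⊢
  rw [show y + v - x = (y - x) + v by abel]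
  linarith [norm_add_le (y - x) v]

variable [CompleteSpace F] {f : E → F} {x : E} {R M : ℝ}

/-- Estimates for a bounded function that is holomorphic along complex lines: it is Lipschitz, and
its line derivatives are first order approximations. -/
theorem line_estimates (hM : ∀ y ∈ ball x R, ‖f y‖ ≤ M)
    (hd : ∀ y ∈ ball x R, ∀ v, LineDifferentiableAt ℂ f y v) {y h : E} {ρ : ℝ}
    (hy : y ∈ ball x (R - ρ)) (hh : ‖h‖ < ρ) :
    ‖f (y + h) - f y‖ ≤ 2 * M / ρ * ‖h‖ ∧ ‖lineDeriv ℂ f y h‖ ≤ 2 * M / ρ * ‖h‖ ∧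
      ‖f (y + h) - f y - lineDeriv ℂ f y h‖ ≤ 4 * M / ρ ^ 2 * ‖h‖ ^ 2 := by
  rcases eq_or_ne h 0 with rfl | hne
  · simp [lineDeriv_zero]
  have hh0 : 0 < ‖h‖ := norm_pos_iff.2 hne
  have hρ : 0 < ρ := hh0.trans hh
  have hmem : ∀ ζ ∈ ball (0 : ℂ) (ρ / ‖h‖), y + ζ • h ∈ ball x R := by
    intro ζ hζ
    refine add_mem_ball_of_norm_lt hy ?_
    rw [norm_smul]
    rwa [mem_ball_zero_iff, lt_div_iff₀ hh0] at hζ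
  set g : ℂ → F := fun ζ => f (y + ζ • h) with hg
  have hgd : DifferentiableOn ℂ g (ball 0 (ρ / ‖h‖)) := fun ζ hζ =>
    (differentiableAt_comp_line (hd _ (hmem ζ hζ) h)).differentiableWithinAt
  have hgM : ∀ ζ ∈ ball (0 : ℂ) (ρ / ‖h‖), ‖g ζ‖ ≤ M := fun ζ hζ => hM _ (hmem ζ hζ)
  have h0 : (0 : ℂ) ∈ ball (0 : ℂ) (ρ / ‖h‖) := mem_ball_self (by positivity)
  have h1 : (1 : ℂ) ∈ ball (0 : ℂ) (ρ / ‖h‖) := by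
    rw [mem_ball_zero_iff, norm_one, lt_div_iff₀ hh0]
    linarith
  have hmaps := mapsTo_closedBall_of_norm_le h0 hgM
  have e : dslope g 0 1 = f (y + h) - f y := by
    rw [dslope_of_ne _ one_ne_zero, slope_def_module]
    simp [hg]
  have e2 : 2 * M / (ρ / ‖h‖) = 2 * M / ρ * ‖h‖ := by field_simp
  have a1 := Complex.norm_dslope_le_div_of_mapsTo_ball hgd hmaps h1
  have a2 := Complex.norm_dslope_le_div_of_mapsTo_ball hgd hmaps h0
  have a3 := norm_dslope_sub_deriv_le hgd hgM h1
  rw [e, e2] at a1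
  rw [dslope_same, e2] at a2
  rw [e, sub_zero, norm_one, mul_one] at a3
  refine ⟨a1, a2, a3.trans (le_of_eq ?_)⟩
  rw [div_pow]
  field_simp

/-- The defect of additivity is a mixed second difference divided by `t`. Applying the Lipschitz
estimate to `f`, then to `y ↦ f (y + t • k) - f y`, makes that difference `O(t²)`. -/
theorem lineDeriv_add_of_bounded (hR : 0 < R) (hM : ∀ y ∈ ball x R, ‖f y‖ ≤ M)
    (hd : ∀ y ∈ ball x R, ∀ v, LineDifferentiableAt ℂ f y v) (h k : E) :
    lineDeriv ℂ f x (h + k) = lineDeriv ℂ f x h + lineDeriv ℂ f x k := by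
  have hxR : x ∈ ball x R := mem_ball_self hR
  have hM0 : 0 ≤ M := (norm_nonneg _).trans (hM x hxR)
  have t1 := (hd x hxR (h + k)).hasLineDerivAt.tendsto_slope_zero
  have t2 := (hd x hxR h).hasLineDerivAt.tendsto_slope_zero
  have t3 := (hd x hxR k).hasLineDerivAt.tendsto_slope_zero
  have t4 := (t1.sub t2).sub t3
  set C : ℝ := 2 * (2 * M / (R / 2) * ‖k‖) / (R / 4) * ‖h‖ with hC
  have t5 : Tendsto (fun t : ℂ => C * ‖t‖) (𝓝[≠] 0) (𝓝 0) := by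
    have : Continuous fun t : ℂ => C * ‖t‖ := by fun_prop
    simpa using (this.tendsto 0).mono_left nhdsWithin_le_nhds
  have hsmall : ∀ v : E, ∀ᶠ t : ℂ in 𝓝[≠] 0, ‖t • v‖ < R / 4 := fun v => by
    have : Continuous fun t : ℂ => ‖t • v‖ := by fun_prop
    exact ((this.tendsto 0).mono_left nhdsWithin_le_nhds).eventually
      (gt_mem_nhds (by simpa using hR))
  have t6 : Tendsto (fun t : ℂ => t⁻¹ • (f (x + t • (h + k)) - f x) - t⁻¹ • (f (x + t • h) - f x) -
      t⁻¹ • (f (x + t • k) - f x)) (𝓝[≠] 0) (𝓝 0) := by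
    refine squeeze_zero_norm' ?_ t5
    filter_upwards [hsmall h, hsmall k, self_mem_nhdsWithin] with t hth htk' ht
    have htk : ‖t • k‖ < R / 2 := htk'.trans (by linarith)
    have ht0 : 0 < ‖t‖ := norm_pos_iff.2 ht
    set φ : E → F := fun y => f (y + t • k) - f y with hφ
    have b1 : ∀ y ∈ ball x (R / 2), ‖φ y‖ ≤ 2 * M / (R / 2) * ‖t • k‖ := fun y hy =>
      (line_estimates hM hd (ρ := R / 2) (by rwa [sub_half]) htk).1
    have b2 : ∀ y ∈ ball x (R / 2), ∀ v, LineDifferentiableAt ℂ φ y v := by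
      intro y hy v
      have c1 := hd (y + t • k) (add_mem_ball_of_norm_lt (ρ := R / 2) (by rwa [sub_half]) htk) v
      have c2 := hd y (ball_subset_ball (by linarith) hy) v
      have c3 : DifferentiableAt ℂ (fun s : ℂ => f (y + t • k + s • v) - f (y + s • v)) 0 :=
        DifferentiableAt.sub c1 c2
      refine c3.congr_of_eventuallyEq (Eventually.of_forall fun s => ?_)
      simp only [hφ, add_right_comm]
    have b3 := (line_estimates b1 b2 (y := x) (h := t • h) (ρ := R / 4)
      (mem_ball_self (by linarith)) hth).1
    have e : t⁻¹ • (f (x + t • (h + k)) - f x) - t⁻¹ • (f (x + t • h) - f x) -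
        t⁻¹ • (f (x + t • k) - f x) = t⁻¹ • (φ (x + t • h) - φ x) := by
      simp only [hφ, smul_sub, smul_add, add_assoc]
      abel
    rw [e, norm_smul, norm_inv, inv_mul_le_iff₀ ht0]
    refine b3.trans (le_of_eq ?_)
    rw [norm_smul, norm_smul, hC]
    ring
  have := tendsto_nhds_unique t4 t6
  rw [sub_sub, sub_eq_zero] at this
  exact this

/-- A bounded function that is holomorphic along complex lines is Fréchet differentiable. -/
theorem differentiableAt_of_lineDifferentiable (hR : 0 < R) (hM : ∀ y ∈ ball x R, ‖f y‖ ≤ M)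
    (hd : ∀ y ∈ ball x R, ∀ v, LineDifferentiableAt ℂ f y v) : DifferentiableAt ℂ f x := by
  have hxR : x ∈ ball x R := mem_ball_self hR
  have hM0 : 0 ≤ M := (norm_nonneg _).trans (hM x hxR)
  have hx2 : x ∈ ball x (R - R / 2) := mem_ball_self (by linarith)
  set A : E →ₗ[ℂ] F :=
    { toFun := lineDeriv ℂ f x
      map_add' := lineDeriv_add_of_bounded hR hM hd
      map_smul' := fun c v => lineDeriv_smul } with hA
  have hAb : ∀ v, ‖A v‖ ≤ 2 * M / (R / 2) * ‖v‖ := by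
    intro v
    obtain ⟨c, hc0, hc⟩ : ∃ c : ℂ, c ≠ 0 ∧ ‖c • v‖ < R / 2 := by
      have : Continuous fun t : ℂ => ‖t • v‖ := by fun_prop
      obtain ⟨c, h1, h2⟩ := ((((this.tendsto 0).mono_left (nhdsWithin_le_nhds (s := {0}ᶜ))).eventually
        (gt_mem_nhds (by simpa using hR : ‖(0 : ℂ) • v‖ < R / 2))).and self_mem_nhdsWithin).exists
      exact ⟨c, h2, h1⟩
    have h1 : ‖A (c • v)‖ ≤ _ := (line_estimates hM hd hx2 hc).2.1
    rw [map_smul, norm_smul, norm_smul] at h1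
    have hc' : 0 < ‖c‖ := norm_pos_iff.2 hc0
    nlinarith
  refine HasFDerivAt.differentiableAt (f' := A.mkContinuous _ hAb) ?_
  rw [hasFDerivAt_iff_isLittleO_nhds_zero]
  have hO : (fun h => f (x + h) - f x - A.mkContinuous _ hAb h) =O[𝓝 0] fun h => ‖h‖ ^ 2 := by
    refine Asymptotics.IsBigO.of_bound (4 * M / (R / 2) ^ 2) ?_
    filter_upwards [ball_mem_nhds (0 : E) (half_pos hR)] with h hh
    rw [mem_ball_zero_iff] at hh
    rw [norm_pow, norm_norm]
    exact (line_estimates hM hd hx2 hh).2.2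
  exact hO.trans_isLittleO (Asymptotics.isLittleO_norm_pow_id one_lt_two)

/-- The derivative of a holomorphic function is holomorphic. -/
theorem differentiableOn_fderiv {U : Set E} (hU : IsOpen U) (hf : DifferentiableOn ℂ f U) :
    DifferentiableOn ℂ (fderiv ℂ f) U := by
  intro x hx
  obtain ⟨R, M, hR, hsub, hM⟩ : ∃ R M : ℝ, 0 < R ∧ ball x R ⊆ U ∧ ∀ y ∈ ball x R, ‖f y‖ ≤ M := by
    have hc := (hf.continuousOn.continuousAt (hU.mem_nhds hx)).norm
    obtain ⟨R, hR, h⟩ := Metric.mem_nhds_iff.1 (inter_mem (hU.mem_nhds hx)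
      (hc.eventually (gt_mem_nhds (lt_add_one _))))
    exact ⟨R, ‖f x‖ + 1, hR, fun y hy => (h hy).1, fun y hy => (h hy).2.le⟩
  have hd : ∀ y ∈ ball x R, DifferentiableAt ℂ f y := fun y hy =>
    hf.differentiableAt (hU.mem_nhds (hsub hy))
  have hdl : ∀ y ∈ ball x R, ∀ v, LineDifferentiableAt ℂ f y v := fun y hy v =>
    (hd y hy).lineDifferentiableAt
  have hbound : ∀ y ∈ ball x (R / 2), ‖fderiv ℂ f y‖ ≤ 2 * M / (R / 2) := by
    intro y hy
    have hs : ball y (R / 2) ⊆ ball x R := ball_subset_ball' (by rw [mem_ball] at hy; linarith)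
    exact Complex.norm_fderiv_le_div_of_mapsTo_ball
      (fun z hz => (hd z (hs hz)).differentiableWithinAt)
      (mapsTo_closedBall_of_norm_le (mem_ball_self (half_pos hR)) fun z hz => hM z (hs hz))
      (half_pos hR)
  have hM0 : 0 ≤ 2 * M / (R / 2) :=
    (norm_nonneg _).trans (hbound x (mem_ball_self (half_pos hR)))
  refine (differentiableAt_of_lineDifferentiable (half_pos hR) hbound
    fun y hy v => ?_).differentiableWithinAt
  obtain ⟨δ, hδ, hδv⟩ : ∃ δ : ℝ, 0 < δ ∧ ∀ ζ ∈ ball (0 : ℂ) δ, y + ζ • v ∈ ball x (R / 2) := by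
    have : Continuous fun ζ : ℂ => y + ζ • v := by fun_prop
    obtain ⟨δ, hδ, h⟩ := Metric.isOpen_iff.1 (isOpen_ball.preimage this) 0 (by simpa using hy)
    exact ⟨δ, hδ, h⟩
  have hmem : ∀ ζ ∈ ball (0 : ℂ) δ, ∀ h : E, ‖h‖ ≤ 1 → ∀ ω ∈ ball (0 : ℂ) (R / 2),
      y + ζ • v + ω • h ∈ ball x R := by
    intro ζ hζ h hh ω hω
    refine add_mem_ball_of_norm_lt (ρ := R / 2) (by rw [sub_half]; exact hδv ζ hζ) ?_
    rw [mem_ball_zero_iff] at hω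
    rw [norm_smul]
    nlinarith [norm_nonneg ω, norm_nonneg h]
  -- Evaluations at vectors of the unit ball norm the operators, and each evaluated derivative is a
  -- partial derivative of `f (y + ζ • v + ω • h)` at `ω = 0`.
  refine differentiableAt_of_norming (ι := {h : E // ‖h‖ ≤ 1})
    (fun h => ContinuousLinearMap.apply ℂ F (h : E)) (fun L C hC h => ?_) hδ hM0
    (fun h => ?_) fun h ζ hζ => ?_
  · refine ContinuousLinearMap.opNorm_le_of_unit_norm hC fun z hz => h ⟨z, hz.le⟩
  · have key := differentiableOn_deriv_of_separately (f := fun ζ ω => f (y + ζ • v + ω • (h : E)))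
      (U := ball (0 : ℂ) δ) isOpen_ball (c := 0) (r := R / 2) (M := M) (half_pos hR)
      (fun ω hω ζ hζ => ?_) (fun ζ hζ ω hω => ?_)
      fun ζ hζ ω hω => hM _ (hmem ζ hζ h h.2 ω hω)
    · refine key.congr fun ζ hζ => ?_
      have := (hd _ (ball_subset_ball (by linarith) (hδv ζ hζ))).lineDeriv_eq_fderiv (v := (h : E))
      simpa [lineDeriv] using this.symm
    · refine DifferentiableAt.differentiableWithinAt ?_
      exact (hd _ (hmem ζ hζ h h.2 ω hω)).comp (f := fun ζ : ℂ => y + ζ • v + ω • (h : E)) ζ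
        (by fun_prop)
    · refine DifferentiableAt.differentiableWithinAt ?_
      exact (hd _ (hmem ζ hζ h h.2 ω hω)).comp (f := fun ω : ℂ => y + ζ • v + ω • (h : E)) ω
        (by fun_prop)
  · exact ((fderiv ℂ f (y + ζ • v)).le_of_opNorm_le (hbound _ (hδv ζ hζ)) _).trans
      (mul_le_of_le_one_right hM0 h.2)

theorem differentiableOn_iteratedFDeriv {U : Set E} (hU : IsOpen U) (hf : DifferentiableOn ℂ f U)
    (n : ℕ) : DifferentiableOn ℂ (iteratedFDeriv ℂ n f) U := by
  induction n with
  | zero =>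
    rw [iteratedFDeriv_zero_eq_comp]
    exact (LinearIsometryEquiv.differentiable _).comp_differentiableOn hf
  | succ n ih =>
    rw [iteratedFDeriv_succ_eq_comp_left]
    have h := differentiableOn_fderiv hU ih
    exact (LinearIsometryEquiv.comp_differentiableOn_iff _).2 h

/-- Cauchy's estimate is iterated, each derivative using up a distance `δ`. Taking `δ = R / (2n)`
gives growth of order `n ^ n`, which `n!` absorbs up to a geometric factor. -/
theorem norm_iteratedFDeriv_le_of_bounded (hf : DifferentiableOn ℂ f (ball x R))
    (hM : ∀ y ∈ ball x R, ‖f y‖ ≤ M) {δ : ℝ} (hδ : 0 < δ) (n : ℕ) :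
    ∀ y, dist y x + n * δ < R → ‖iteratedFDeriv ℂ n f y‖ ≤ M * (2 / δ) ^ n := by
  induction n with
  | zero => exact fun y hy => by simpa using hM y (by simpa using hy)
  | succ n ih =>
    intro y hy
    push_cast at hy
    have hn : 0 ≤ n * δ := by positivity
    have hs : ball y δ ⊆ ball x R := ball_subset_ball' (by linarith)
    have hb : ∀ z ∈ ball y δ, ‖iteratedFDeriv ℂ n f z‖ ≤ M * (2 / δ) ^ n := by
      intro z hz
      refine ih z ?_
      rw [mem_ball] at hz
      linarith [dist_triangle z y x]
    rw [← norm_fderiv_iteratedFDeriv]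
    refine (Complex.norm_fderiv_le_div_of_mapsTo_ball
      ((differentiableOn_iteratedFDeriv isOpen_ball hf n).mono hs)
      (mapsTo_closedBall_of_norm_le (mem_ball_self hδ) hb) hδ).trans (le_of_eq ?_)
    rw [pow_succ]
    ring

theorem iteratedDeriv_comp_line {U : Set E} (hU : IsOpen U) (hf : DifferentiableOn ℂ f U)
    (v : E) (n : ℕ) :
    ∀ ζ : ℂ, x + ζ • v ∈ U →
      iteratedDeriv n (fun ξ : ℂ => f (x + ξ • v)) ζ =
        iteratedFDeriv ℂ n f (x + ζ • v) fun _ => v := by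
  induction n with
  | zero => simp
  | succ n ih =>
    intro ζ hζ
    have hV : IsOpen {ξ : ℂ | x + ξ • v ∈ U} :=
      hU.preimage (by fun_prop : Continuous fun ξ : ℂ => x + ξ • v)
    have he : iteratedDeriv n (fun ξ : ℂ => f (x + ξ • v)) =ᶠ[𝓝 ζ]
        fun ξ => iteratedFDeriv ℂ n f (x + ξ • v) fun _ => v :=
      eventually_of_mem (hV.mem_nhds hζ) ih
    rw [iteratedDeriv_succ, he.deriv_eq, iteratedFDeriv_succ_apply_left]
    have h1 := ((differentiableOn_iteratedFDeriv hU hf n).differentiableAt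
      (hU.mem_nhds hζ)).hasFDerivAt
    have h2 : HasDerivAt (fun ξ : ℂ => x + ξ • v) v ζ := by
      simpa using ((hasDerivAt_id ζ).smul_const v).const_add x
    have h3 := h1.comp_hasDerivAt ζ h2
    exact ((ContinuousMultilinearMap.apply ℂ (fun _ : Fin n => E) F
      (fun _ => v)).hasFDerivAt.comp_hasDerivAt ζ h3).deriv

/-- A holomorphic function on an open subset of a complex normed space is analytic. -/
theorem analyticOnNhd_of_differentiableOn {U : Set E} (hU : IsOpen U)
    (hf : DifferentiableOn ℂ f U) : AnalyticOnNhd ℂ f U := by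
  intro x hx
  obtain ⟨R, M, hR, hsub, hM⟩ : ∃ R M : ℝ, 0 < R ∧ ball x R ⊆ U ∧ ∀ y ∈ ball x R, ‖f y‖ ≤ M := by
    have hc := (hf.continuousOn.continuousAt (hU.mem_nhds hx)).norm
    obtain ⟨R, hR, h⟩ := Metric.mem_nhds_iff.1 (inter_mem (hU.mem_nhds hx)
      (hc.eventually (gt_mem_nhds (lt_add_one _))))
    exact ⟨R, ‖f x‖ + 1, hR, fun y hy => (h hy).1, fun y hy => (h hy).2.le⟩
  have hM0 : 0 ≤ M := (norm_nonneg _).trans (hM x (mem_ball_self hR))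
  set p : FormalMultilinearSeries ℂ E F := fun n => (n.factorial : ℂ)⁻¹ • iteratedFDeriv ℂ n f x
    with hp
  -- The bounds give terms at most `M (n ^ n / n!) (4r / R) ^ n ≤ M (4er / R) ^ n`, and this `r`
  -- makes the ratio `1 / 2`.
  set r : ℝ := R / (8 * Real.exp 1) with hr
  have hr0 : 0 < r := by positivity
  have hrR : r < R / 2 := by
    rw [hr, div_lt_div_iff_of_pos_left hR (by positivity) two_pos]
    nlinarith [Real.add_one_le_exp (1 : ℝ)]
  refine ⟨p, ENNReal.ofReal r, ?_, by simpa using hr0, fun {y} hy => ?_⟩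
  · refine p.le_radius_of_bound M (r := r.toNNReal) fun n => ?_
    rw [Real.coe_toNNReal _ hr0.le, hp]
    rcases n.eq_zero_or_pos with rfl | hn
    · simpa using hM x (mem_ball_self hR)
    have hn0 : (0 : ℝ) < n := by exact_mod_cast hn
    have hδ : 0 < R / (2 * n) := by positivity
    have h1 := norm_iteratedFDeriv_le_of_bounded (hf.mono hsub) hM hδ n x (by
      rw [dist_self, zero_add, show (n : ℝ) * (R / (2 * n)) = R / 2 by field_simp]
      linarith)
    have h2 : (n : ℝ) ^ n / n.factorial ≤ Real.exp n := by
      exact Real.pow_div_factorial_le_exp _ hn0.le n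
    rw [norm_smul, norm_inv, Complex.norm_natCast]
    calc _ ≤ (n.factorial : ℝ)⁻¹ * (M * (2 / (R / (2 * n))) ^ n) * r ^ n := by gcongr
      _ = M * ((n : ℝ) ^ n / n.factorial) * (1 / (2 * Real.exp 1)) ^ n := by
        rw [show 2 / (R / (2 * n)) = n * (4 / R) by field_simp; norm_num, hr, mul_pow (n : ℝ)]
        rw [show M * ((n : ℝ) ^ n / n.factorial) * (1 / (2 * Real.exp 1)) ^ n =
          (n.factorial : ℝ)⁻¹ * M * n ^ n * (4 / R * (R / (8 * Real.exp 1))) ^ n by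
            rw [show 4 / R * (R / (8 * Real.exp 1)) = 1 / (2 * Real.exp 1) by field_simp; norm_num]
            ring]
        rw [mul_pow (4 / R)]
        ring
      _ ≤ M * Real.exp n * (1 / (2 * Real.exp 1)) ^ n := by gcongr
      _ = M * (1 / 2) ^ n := by
        rw [← Real.exp_one_pow, mul_assoc, ← mul_pow]
        congr 2
        field_simp
      _ ≤ M := mul_le_of_le_one_right hM0 (pow_le_one₀ (by norm_num) (by norm_num))
  · have hy' : ‖y‖ < R / 2 := by
      rw [Metric.eball_ofReal, mem_ball_zero_iff] at hy
      linarith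
    have hmem : ∀ ζ ∈ ball (0 : ℂ) 2, x + ζ • y ∈ U := by
      intro ζ hζ
      rw [mem_ball_zero_iff] at hζ
      refine hsub ?_
      rw [mem_ball, dist_eq_norm, add_sub_cancel_left, norm_smul]
      nlinarith [norm_nonneg ζ, norm_nonneg y]
    -- The sum is identified on the complex line through `x` in direction `y`: it is a one-variable
    -- Taylor series at `ζ = 1`.
    have hg : DifferentiableOn ℂ (fun ζ : ℂ => f (x + ζ • y)) (ball 0 2) := fun ζ hζ =>
      (((hf.differentiableAt (hU.mem_nhds (hmem ζ hζ))).comp (f := fun ζ : ℂ => x + ζ • y) ζ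
        (by fun_prop))).differentiableWithinAt
    have h1 := Complex.hasSum_taylorSeries_on_ball hg (z := 1) (by simp)
    convert h1 using 1
    · funext n
      rw [iteratedDeriv_comp_line hU hf y n 0 (by simpa using hx)]
      simp [hp]
    · simp

/-- A bounded function that is holomorphic along complex lines is analytic. -/
theorem analyticOnNhd_of_lineDifferentiable {U : Set E} (hU : IsOpen U)
    (hM : ∀ y ∈ U, ‖f y‖ ≤ M) (hd : ∀ y ∈ U, ∀ v, LineDifferentiableAt ℂ f y v) :
    AnalyticOnNhd ℂ f U := by
  refine analyticOnNhd_of_differentiableOn hU fun x hx => ?_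
  obtain ⟨R, hR, hsub⟩ := Metric.isOpen_iff.1 hU x hx
  exact (differentiableAt_of_lineDifferentiable hR (fun y hy => hM y (hsub hy))
    fun y hy => hd y (hsub hy)).differentiableWithinAt

end Gateaux

/-! ### Families with equal Gram matrices -/

section Gram

open scoped InnerProductSpace TensorProduct

variable {ι H H' : Type*} [NormedAddCommGroup H] [InnerProductSpace ℂ H] [NormedAddCommGroup H']
  [InnerProductSpace ℂ H']

theorem inner_linearCombination_eq {a : ι → H} {b : ι → H'} {m : H} {y : H'}
    (h : ∀ i, ⟪y, b i⟫_ℂ = ⟪m, a i⟫_ℂ) (ξ : ι →₀ ℂ) :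
    ⟪y, Finsupp.linearCombination ℂ b ξ⟫_ℂ = ⟪m, Finsupp.linearCombination ℂ a ξ⟫_ℂ := by
  simp only [Finsupp.linearCombination_apply, Finsupp.inner_sum, inner_smul_right, h]

theorem norm_linearCombination_sq_eq {a : ι → H} {b : ι → H'} {c : ℝ}
    (h : ∀ i j, ⟪b i, b j⟫_ℂ = c * ⟪a i, a j⟫_ℂ) (ξ : ι →₀ ℂ) :
    ‖Finsupp.linearCombination ℂ b ξ‖ ^ 2 = c * ‖Finsupp.linearCombination ℂ a ξ‖ ^ 2 := by
  have h1 : ⟪Finsupp.linearCombination ℂ b ξ, Finsupp.linearCombination ℂ b ξ⟫_ℂ =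
      c * ⟪Finsupp.linearCombination ℂ a ξ, Finsupp.linearCombination ℂ a ξ⟫_ℂ := by
    simp only [Finsupp.linearCombination_apply, Finsupp.inner_sum, Finsupp.sum_inner,
      inner_smul_right, inner_smul_left, h, Finsupp.mul_sum]
    refine Finsupp.sum_congr fun i _ => Finsupp.sum_congr fun j _ => ?_
    ring
  rw [inner_self_eq_norm_sq_to_K, inner_self_eq_norm_sq_to_K] at h1
  refine Complex.ofReal_injective ?_
  push_cast
  simpa using h1

/-- Let `a` and `b` be families with the same Gram matrix, and let `y` represent on the family `b`
the functional that `m` represents on `a`. If `m` is in the closed span of `a` and `‖y‖ ≤ ‖m‖`, then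
`y` is in the closed span of `b`. -/
theorem inner_eq_zero_of_gram_eq {a : ι → H} {b : ι → H'}
    (hab : ∀ i j, ⟪b i, b j⟫_ℂ = ⟪a i, a j⟫_ℂ) (ha : DenseRange (Finsupp.linearCombination ℂ a))
    {m : H} {y : H'} (hy : ∀ i, ⟪y, b i⟫_ℂ = ⟪m, a i⟫_ℂ) (hle : ‖y‖ ≤ ‖m‖) {t : H'}
    (ht : ∀ i, ⟪b i, t⟫_ℂ = 0) : ⟪y, t⟫_ℂ = 0 := by
  have hbt : ∀ ξ, ⟪Finsupp.linearCombination ℂ b ξ, t⟫_ℂ = 0 := fun ξ => by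
    simp only [Finsupp.linearCombination_apply, Finsupp.sum_inner, inner_smul_left, ht, mul_zero]
    exact Finset.sum_const_zero
  -- The cross terms and the norms of the combinations agree, so only `‖y‖ ≤ ‖m‖` matters:
  -- approximating `m` by `a` approximates `y` by `b` at least as well.
  have hdist : ∀ ξ, ‖y - Finsupp.linearCombination ℂ b ξ‖ ≤
      ‖m - Finsupp.linearCombination ℂ a ξ‖ := by
    intro ξ
    refine (sq_le_sq₀ (norm_nonneg _) (norm_nonneg _)).1 ?_
    have h1 := norm_linearCombination_sq_eq (c := 1) (by simpa using hab) ξ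
    rw [norm_sub_sq (𝕜 := ℂ), norm_sub_sq (𝕜 := ℂ), inner_linearCombination_eq hy, h1, one_mul]
    have : ‖y‖ ^ 2 ≤ ‖m‖ ^ 2 := by gcongr
    linarith
  rw [← norm_eq_zero]
  refine le_antisymm (le_of_forall_pos_le_add fun ε hε => ?_) (norm_nonneg _)
  obtain ⟨ξ, hξ⟩ := ha.exists_dist_lt m (ε := ε / (‖t‖ + 1)) (by positivity)
  have e : ⟪y, t⟫_ℂ = ⟪y - Finsupp.linearCombination ℂ b ξ, t⟫_ℂ := by
    rw [inner_sub_left, hbt, sub_zero]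
  rw [dist_eq_norm, lt_div_iff₀ (by positivity)] at hξ
  have h2 := norm_inner_le_norm (𝕜 := ℂ) (y - Finsupp.linearCombination ℂ b ξ) t
  rw [e]
  have h3 := hdist ξ
  nlinarith [norm_nonneg t, norm_nonneg (m - Finsupp.linearCombination ℂ a ξ)]

end Gram

/-! ### Spaces with quasiscalar kernels -/

section Quasiscalar

open scoped InnerProductSpace ComplexConjugate
open RKHS

variable {X E H : Type*} [NormedAddCommGroup E] [InnerProductSpace ℂ E] [CompleteSpace E]
  [NormedAddCommGroup H] [InnerProductSpace ℂ H] [CompleteSpace H] [RKHS ℂ H X E] {k : X → X → ℂ}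

theorem kerFun_apply_quasiscalar (hk : kernel H = quasiscalar E k) (w x : X) (v : E) :
    kerFun H w v x = k x w • v := by
  rw [kerFun_apply, hk]
  rfl

theorem inner_kerFun_kerFun (hk : kernel H = quasiscalar E k) (x y : X) (u v : E) :
    ⟪kerFun H x u, kerFun H y v⟫_ℂ = k x y * ⟪u, v⟫_ℂ := by
  rw [kerFun_inner, kerFun_apply_quasiscalar hk, inner_smul_right]

theorem norm_kerFun_sq (hk : kernel H = quasiscalar E k) (x : X) (v : E) :
    ‖kerFun H x v‖ ^ 2 = ‖k x x‖ * ‖v‖ ^ 2 := by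
  have h := congrArg norm (inner_kerFun_kerFun hk x x v v)
  rw [inner_self_eq_norm_sq_to_K, inner_self_eq_norm_sq_to_K] at h
  simpa using h

theorem conj_kernel {H : Type*} [NormedAddCommGroup H] [InnerProductSpace ℂ H] [CompleteSpace H]
    [RKHS ℂ H X ℂ] (hk : kernel H = quasiscalar ℂ k) (x y : X) : conj (k x y) = k y x := by
  have h := inner_conj_symm (𝕜 := ℂ) (kerFun H y (1 : ℂ)) (kerFun H x (1 : ℂ))
  rw [inner_kerFun_kerFun hk, inner_kerFun_kerFun hk] at h
  simpa using h

variable (H) in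
theorem denseRange_linearCombination_kerFun :
    DenseRange (Finsupp.linearCombination ℂ fun p : X × E => kerFun H p.1 p.2) := by
  have h := Submodule.dense_iff_topologicalClosure_eq_top.2 (kerFun_dense (𝕜 := ℂ) H)
  have e : {x : H | ∃ (y : X) (v : E), kerFun H y v = x} =
      Set.range fun p : X × E => kerFun H p.1 p.2 := by
    ext
    simp
  rw [e, ← Finsupp.range_linearCombination] at h
  rw [DenseRange, ← LinearMap.coe_range]
  exact h

theorem clm_ext_kerFun {G : Type*} [NormedAddCommGroup G] [NormedSpace ℂ G] {S T : H →L[ℂ] G}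
    (h : ∀ x v, S (kerFun H x v) = T (kerFun H x v)) : S = T := by
  refine ContinuousLinearMap.ext_on
    (Submodule.dense_iff_topologicalClosure_eq_top.2 (kerFun_dense (𝕜 := ℂ) H)) ?_
  rintro _ ⟨x, v, rfl⟩
  exact h x v

/-- Multiplication of scalar functions by a fixed vector maps the space with the scalar kernel `k`
to the space with the kernel `k I`. -/
theorem exists_clm_smul {Hs : Type*} [NormedAddCommGroup Hs] [InnerProductSpace ℂ Hs]
    [CompleteSpace Hs] [RKHS ℂ Hs X ℂ] (hs : kernel Hs = quasiscalar ℂ k)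
    (hk : kernel H = quasiscalar E k) (u : E) :
    ∃ S : Hs →L[ℂ] H, (∀ f x, S f x = f x • u) ∧ ∀ x, S (kerFun Hs x (1 : ℂ)) = kerFun H x u := by
  set a : X × ℂ → Hs := fun p => kerFun Hs p.1 p.2 with ha
  set b : X × ℂ → H := fun p => kerFun H p.1 (p.2 • u) with hb
  have hgram : ∀ p q, ⟪b p, b q⟫_ℂ = ((‖u‖ ^ 2 : ℝ) : ℂ) * ⟪a p, a q⟫_ℂ := by
    intro p q
    simp only [ha, hb, inner_kerFun_kerFun hs, inner_kerFun_kerFun hk, inner_smul_left,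
      inner_smul_right, inner_self_eq_norm_sq_to_K]
    simp
    ring
  have hnorm : ∃ C : ℝ, ∀ ξ, ‖Finsupp.linearCombination ℂ b ξ‖ ≤
      C * ‖Finsupp.linearCombination ℂ a ξ‖ := by
    refine ⟨‖u‖, fun ξ => (sq_le_sq₀ (norm_nonneg _) (by positivity)).1 ?_⟩
    rw [norm_linearCombination_sq_eq hgram, mul_pow]
  have hdense : DenseRange (Finsupp.linearCombination ℂ a) := denseRange_linearCombination_kerFun Hs
  set S := (Finsupp.linearCombination ℂ b).extendOfNorm (Finsupp.linearCombination ℂ a) with hS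
  have hSk : ∀ x c, S (kerFun Hs x c) = kerFun H x (c • u) := by
    intro x c
    have := LinearMap.extendOfNorm_eq hdense hnorm (Finsupp.single (x, c) 1)
    rwa [Finsupp.linearCombination_single, one_smul, Finsupp.linearCombination_single,
      one_smul] at this
  refine ⟨S, fun f x => ?_, fun x => by simpa using hSk x 1⟩
  -- The adjoint of `kerFun H x` is evaluation at `x`, so the pointwise formula is an operator
  -- identity, checked on kernel functions.
  have h1 : (kerFun H x).adjoint ∘L S =
      (ContinuousLinearMap.toSpanSingleton ℂ u) ∘L (kerFun Hs x).adjoint := by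
    refine clm_ext_kerFun fun y c => ?_
    simp [hSk, kerFun_apply_quasiscalar hs, kerFun_apply_quasiscalar hk, mul_smul, smul_comm c]
  simpa using congrArg (fun T : Hs →L[ℂ] E => T f) h1

/-- If the kernel is holomorphic in the first variable along a parametrized disc, then all functions
of the space are holomorphic along a smaller concentric disc. -/
theorem exists_differentiableOn_comp (hk : kernel H = quasiscalar E k)
    (hherm : ∀ x y, conj (k x y) = k y x) {c : ℂ → X} {R : ℝ} (hR : 0 < R)
    (hc : ∀ w, DifferentiableOn ℂ (fun ζ => k (c ζ) w) (ball 0 R)) :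
    ∃ r, 0 < r ∧ ∀ h : H, DifferentiableOn ℂ (fun ζ => h (c ζ)) (ball 0 r) := by
  have hconj : ∀ ζ ∈ ball (0 : ℂ) R, conj ζ ∈ ball (0 : ℂ) R := fun ζ hζ => by simpa using hζ
  -- Hermitian symmetry and conjugating the second parameter make the kernel separately holomorphic.
  -- Setting `ω = conj ζ` in the Hartogs bound controls the diagonal.
  obtain ⟨r₀, C, hr₀, hC⟩ := exists_bounded_nhds_of_separately
    (f := fun ζ ω => k (c ζ) (c (conj ω))) hR (fun ω _ => hc _) (fun ζ _ ω hω => by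
      have h1 := ((hc (c ζ)).differentiableAt (isOpen_ball.mem_nhds (hconj ω hω))).conj_conj
      rw [Complex.conj_conj] at h1
      refine (h1.congr_of_eventuallyEq (Eventually.of_forall fun ω' => ?_)).differentiableWithinAt
      simp [hherm])
  set r := min r₀ R with hr
  have hr0 : 0 < r := lt_min hr₀ hR
  have hbound : ∀ x ∈ c '' ball 0 r, ‖kerFun H x‖ ≤ Real.sqrt C := by
    rintro _ ⟨ζ, hζ, rfl⟩
    have hζ₀ : ζ ∈ ball (0 : ℂ) r₀ := ball_subset_ball (min_le_left _ _) hζ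
    have h1 : ‖k (c ζ) (c ζ)‖ ≤ C := by
      simpa using hC ζ hζ₀ (conj ζ) (by simpa using hζ₀)
    refine ContinuousLinearMap.opNorm_le_bound _ (Real.sqrt_nonneg _) fun v => ?_
    refine (sq_le_sq₀ (norm_nonneg _) (by positivity)).1 ?_
    rw [norm_kerFun_sq hk, mul_pow, Real.sq_sqrt ((norm_nonneg _).trans h1)]
    gcongr
  refine ⟨r, hr0, fun h => ?_⟩
  have hspan : ∀ g ∈ Submodule.span ℂ {kerFun H x v | (x : X) (v : E)},
      DifferentiableOn ℂ (fun ζ => g (c ζ)) (ball 0 r) := by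
    intro g hg
    induction hg using Submodule.span_induction with
    | mem g hg =>
      obtain ⟨x, v, rfl⟩ := hg
      simp only [kerFun_apply_quasiscalar hk]
      exact ((hc x).mono (ball_subset_ball (min_le_right _ _))).smul_const v
    | zero => simp
    | add f g _ _ hf hg =>
      simp only [coe_add, Pi.add_apply]
      exact hf.add hg
    | smul a f _ hf =>
      simp only [coe_smul, Pi.smul_apply]
      exact hf.const_smul a
  have hh : h ∈ closure (Submodule.span ℂ {kerFun H x v | (x : X) (v : E)} : Set H) :=
    Submodule.dense_iff_topologicalClosure_eq_top.2 (kerFun_dense (𝕜 := ℂ) H) h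
  obtain ⟨u, hu, hlim⟩ := mem_closure_iff_seq_limit.1 hh
  have hunif := (tendstoUniformlyOn_of_norm_kerFun_le hbound hlim).comp c
  exact (hunif.mono (subset_preimage_image c _)).tendstoLocallyUniformlyOn.differentiableOn
    (Eventually.of_forall fun n => hspan _ (hu n)) isOpen_ball

end Quasiscalar

theorem norm_mulOp_apply {X E H : Type*} [NormedAddCommGroup E] [InnerProductSpace ℂ E]
    [NormedAddCommGroup H] [InnerProductSpace ℂ H] [CompleteSpace H] [RKHS ℂ H X E]
    {φ : X → E →L[ℂ] E} (hφ : IsMultiplier H H φ) (hiso : Isometry (mulOp hφ)) (f : H) :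
    ‖mulOp hφ f‖ = ‖f‖ :=
  AddMonoidHomClass.isometry_iff_norm (mulOp hφ) |>.1 hiso f

/-! ### Diagonal values and norms of multipliers -/

section NonvanishingDiagonal

open scoped InnerProductSpace
open RKHS

variable {X E H : Type*} [NormedAddCommGroup E] [InnerProductSpace ℂ E] [CompleteSpace E]
  [NormedAddCommGroup H] [InnerProductSpace ℂ H] [CompleteSpace H] [RKHS ℂ H X E] {k : X → X → ℂ}

theorem apply_eq_zero_of_kernel_self_eq_zero (hk : kernel H = quasiscalar E k) {w : X}
    (hw : k w w = 0) (f : H) : f w = 0 := by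
  have h0 : kerFun H w (f w) = 0 := by
    have h := norm_kerFun_sq hk w (f w)
    simpa [hw] using h
  have h := kerFun_inner (𝕜 := ℂ) w (f w) f
  rw [h0, inner_zero_left] at h
  exact inner_self_eq_zero.1 h.symm

/-- If the norm of every multiplication operator is the supremum norm of the multiplier, then the
kernel does not vanish on the diagonal: otherwise a function supported at one point would multiply
by zero. -/
theorem kernel_self_ne_zero_of_isLUB [Nontrivial E] (hk : kernel H = quasiscalar E k)
    (h_norm : ∀ (φ : X → E →L[ℂ] E) (h : IsMultiplier H H φ),
      IsLUB (Set.range fun z => ‖φ z‖) ‖mulOp h‖) (w : X) : k w w ≠ 0 := by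
  classical
  intro hw
  set ψ : X → E →L[ℂ] E := Pi.single w (ContinuousLinearMap.id ℂ E) with hψ
  have hψf : ∀ (f : H) x, ψ x (f x) = 0 := by
    intro f x
    by_cases hx : x = w
    · rw [hx, apply_eq_zero_of_kernel_self_eq_zero hk hw, map_zero]
    · simp [hψ, Pi.single_eq_of_ne hx]
  have hmul : IsMultiplier H H ψ := fun f => ⟨0, fun x => by simp [hψf]⟩
  have h0 : mulOp hmul = 0 := by
    ext f x
    simp [mulOp_apply, hψf]
  have h1 := (h_norm ψ hmul).1 ⟨w, rfl⟩
  simp only [h0, norm_zero, hψ, Pi.single_eq_same, ContinuousLinearMap.norm_id] at h1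
  exact absurd h1 (by norm_num)

/-- If `k₂ w w = 0`, evaluation at `w` vanishes on a dense subset of `H₁`, hence everywhere,
including on the kernel function whose value there is `k₁ w w`. -/
theorem kernel_self_ne_zero_of_dense {H₁ H₂ : Type*} [NormedAddCommGroup H₁]
    [InnerProductSpace ℂ H₁] [CompleteSpace H₁] [RKHS ℂ H₁ X ℂ] [NormedAddCommGroup H₂]
    [InnerProductSpace ℂ H₂] [CompleteSpace H₂] [RKHS ℂ H₂ X ℂ] {k₁ k₂ : X → X → ℂ}
    (h₁ : kernel H₁ = quasiscalar ℂ k₁) (h₂ : kernel H₂ = quasiscalar ℂ k₂)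
    (h_dense : Dense {f : H₁ | ∃ g : H₂, ∀ z, g z = f z}) {w : X} (hw : k₁ w w ≠ 0) :
    k₂ w w ≠ 0 := by
  intro hw₂
  have hz : ∀ f : H₁, f w = 0 := by
    refine h_dense.induction ?_ (isClosed_eq (continuous_eval w) continuous_const)
    rintro f ⟨g, hg⟩
    rw [← hg, apply_eq_zero_of_kernel_self_eq_zero h₂ hw₂]
  have h := hz (kerFun H₁ w (1 : ℂ))
  rw [kerFun_apply_quasiscalar h₁] at h
  exact hw (by simpa using h)

variable {φ : X → E →L[ℂ] E}

theorem mulOp_kerFun_apply (hk : kernel H = quasiscalar E k) (hφ : IsMultiplier H H φ) (w x : X)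
    (v : E) : mulOp hφ (kerFun H w v) x = k x w • φ x v := by
  rw [mulOp_apply, kerFun_apply_quasiscalar hk, map_smul]

/-- Pair `K_w (φ w v)` with `M_φ K_w v` and apply Cauchy–Schwarz; `k w w` cancels. -/
theorem norm_le_one_of_isometry (hk : kernel H = quasiscalar E k) (hφ : IsMultiplier H H φ)
    (hiso : Isometry (mulOp hφ)) {w : X} (hw : k w w ≠ 0) : ‖φ w‖ ≤ 1 := by
  refine ContinuousLinearMap.opNorm_le_bound _ zero_le_one fun v => ?_
  rw [one_mul]
  have hpos : 0 < ‖k w w‖ := norm_pos_iff.2 hw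
  have hker : ∀ v, ‖kerFun H w v‖ = Real.sqrt ‖k w w‖ * ‖v‖ := fun v => by
    rw [← Real.sqrt_sq (norm_nonneg (kerFun H w v)), norm_kerFun_sq hk, Real.sqrt_mul (norm_nonneg _),
      Real.sqrt_sq (norm_nonneg _)]
  have h := norm_inner_le_norm (𝕜 := ℂ) (kerFun H w (φ w v)) (mulOp hφ (kerFun H w v))
  rw [kerFun_inner, mulOp_kerFun_apply hk, inner_smul_right, norm_mul, norm_mulOp_apply hφ hiso,
    hker, hker, inner_self_eq_norm_sq_to_K] at h
  have h' : ‖k w w‖ * ‖φ w v‖ ^ 2 ≤ ‖k w w‖ * (‖φ w v‖ * ‖v‖) := by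
    have e := Real.mul_self_sqrt (norm_nonneg (k w w))
    have h2 : ‖k w w‖ * ‖φ w v‖ ^ 2 ≤
        (√‖k w w‖ * ‖φ w v‖) * (√‖k w w‖ * ‖v‖) := by simpa using h
    calc _ ≤ _ := h2
      _ = (√‖k w w‖ * √‖k w w‖) * (‖φ w v‖ * ‖v‖) := by ring
      _ = _ := by rw [e]
  have h3 := le_of_mul_le_mul_left h' hpos
  rcases (norm_nonneg (φ w v)).eq_or_lt with h0 | h0
  · rw [← h0]
    exact norm_nonneg v
  · rw [sq] at h3
    exact le_of_mul_le_mul_left h3 h0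

/-- Constancy on the support of `k(·, w)` gives `M_φ K_w v = K_w (φ w v)`; compare norms. -/
theorem norm_apply_of_forall_eq (hk : kernel H = quasiscalar E k) (hφ : IsMultiplier H H φ)
    (hiso : Isometry (mulOp hφ)) {w : X} (hw : k w w ≠ 0) (hconst : ∀ x, k x w ≠ 0 → φ x = φ w)
    (v : E) : ‖φ w v‖ = ‖v‖ := by
  have e : mulOp hφ (kerFun H w v) = kerFun H w (φ w v) := by
    ext x
    rw [mulOp_kerFun_apply hk, kerFun_apply_quasiscalar hk]
    by_cases hx : k x w = 0
    · simp [hx]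
    · rw [hconst x hx]
  have h := norm_mulOp_apply hφ hiso (kerFun H w v)
  rw [e] at h
  have h2 := norm_kerFun_sq hk w (φ w v)
  rw [h, norm_kerFun_sq hk] at h2
  have h3 := mul_left_cancel₀ (norm_ne_zero_iff.2 hw) h2
  exact ((sq_eq_sq₀ (norm_nonneg _) (norm_nonneg _)).1 h3).symm

end NonvanishingDiagonal

/-! ### The tensor product argument -/

section Factorization

open scoped InnerProductSpace TensorProduct ComplexConjugate
open RKHS

variable {X E H H₁ Hs₁ Hs₂ : Type*} [NormedAddCommGroup E] [InnerProductSpace ℂ E]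
  [CompleteSpace E] [NormedAddCommGroup H] [InnerProductSpace ℂ H] [CompleteSpace H] [RKHS ℂ H X E]
  [NormedAddCommGroup H₁] [InnerProductSpace ℂ H₁] [CompleteSpace H₁] [RKHS ℂ H₁ X E]
  [NormedAddCommGroup Hs₁] [InnerProductSpace ℂ Hs₁] [CompleteSpace Hs₁] [RKHS ℂ Hs₁ X ℂ]
  [NormedAddCommGroup Hs₂] [InnerProductSpace ℂ Hs₂] [CompleteSpace Hs₂] [RKHS ℂ Hs₂ X ℂ]
  {k₁ k₂ : X → X → ℂ} {φ : X → E →L[ℂ] E}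

/-- An isometric multiplier of the space with kernel `k₂ k₁ I` that is a contractive multiplier of
the space with kernel `k₁ I` is constant on the pairs of points where `k₁` does not vanish. -/
theorem eq_of_kernel_ne_zero (hs₁ : kernel Hs₁ = quasiscalar ℂ k₁)
    (hs₂ : kernel Hs₂ = quasiscalar ℂ k₂) (h₁ : kernel H₁ = quasiscalar E k₁)
    (hk : kernel H = quasiscalar E fun z w => k₂ z w * k₁ z w)
    (h_dense : Dense {f : Hs₁ | ∃ g : Hs₂, ∀ z, g z = f z}) (hφ : IsMultiplier H H φ)
    (hiso : Isometry (mulOp hφ)) (hφ₁ : IsMultiplier H₁ H₁ φ) (hT : ‖mulOp hφ₁‖ ≤ 1) {w x : X}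
    (hw : k₁ w w ≠ 0) (hwx : k₁ w x ≠ 0) : φ x = φ w := by
  ext v
  refine ext_inner_right ℂ fun u => ?_
  obtain ⟨S, hS, hSk⟩ := exists_clm_smul hs₁ h₁ u
  set Y : H₁ := mulOp hφ₁ (kerFun H₁ w v) with hY
  set a : X × E → H := fun p => kerFun H p.1 p.2 with ha
  set b : X × E → H₁ ⊗[ℂ] Hs₂ := fun p => kerFun H₁ p.1 p.2 ⊗ₜ kerFun Hs₂ p.1 (1 : ℂ) with hb
  have hgram : ∀ p q, ⟪b p, b q⟫_ℂ = ⟪a p, a q⟫_ℂ := by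
    intro p q
    simp only [ha, hb, TensorProduct.inner_tmul, inner_kerFun_kerFun hk, inner_kerFun_kerFun h₁,
      inner_kerFun_kerFun hs₂]
    simp
    ring
  have hy : ∀ p, ⟪Y ⊗ₜ[ℂ] kerFun Hs₂ w (1 : ℂ), b p⟫_ℂ = ⟪mulOp hφ (kerFun H w v), a p⟫_ℂ := by
    intro p
    simp only [ha, hb, hY, TensorProduct.inner_tmul, inner_kerFun, mulOp_kerFun_apply h₁,
      mulOp_kerFun_apply hk, kerFun_apply_quasiscalar hs₂, inner_smul_left, map_mul]
    simp
    ring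
  have hle : ‖Y ⊗ₜ[ℂ] kerFun Hs₂ w (1 : ℂ)‖ ≤ ‖mulOp hφ (kerFun H w v)‖ := by
    rw [norm_mulOp_apply hφ hiso, TensorProduct.norm_tmul]
    refine (sq_le_sq₀ (by positivity) (norm_nonneg _)).1 ?_
    rw [norm_kerFun_sq hk, mul_pow, norm_kerFun_sq hs₂, norm_mul]
    have h2 : ‖Y‖ ≤ ‖kerFun H₁ w v‖ := by
      simpa using (mulOp hφ₁).le_of_opNorm_le hT (kerFun H₁ w v)
    have h3 : ‖Y‖ ^ 2 ≤ ‖k₁ w w‖ * ‖v‖ ^ 2 := by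
      rw [← norm_kerFun_sq h₁]
      gcongr
    calc ‖Y‖ ^ 2 * (‖k₂ w w‖ * ‖(1 : ℂ)‖ ^ 2) = ‖k₂ w w‖ * ‖Y‖ ^ 2 := by simp [mul_comm]
      _ ≤ ‖k₂ w w‖ * (‖k₁ w w‖ * ‖v‖ ^ 2) := by gcongr
      _ = _ := by ring
  have hcomm : ∀ f g : Hs₁, ⟪Y, S f⟫_ℂ * g w = ⟪Y, S g⟫_ℂ * f w := by
    have hc : Continuous fun f : Hs₁ => f w := continuous_eval w
    have hc' : Continuous fun f : Hs₁ => ⟪Y, S f⟫_ℂ := by fun_prop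
    suffices h : ∀ p : Hs₁ × Hs₁, ⟪Y, S p.1⟫_ℂ * p.2 w = ⟪Y, S p.2⟫_ℂ * p.1 w from
      fun f g => h (f, g)
    refine (h_dense.prod h_dense).induction ?_ (isClosed_eq
      ((hc'.comp continuous_fst).mul (hc.comp continuous_snd))
      ((hc'.comp continuous_snd).mul (hc.comp continuous_fst)))
    rintro ⟨f, g⟩ ⟨⟨f', hf⟩, ⟨g', hg⟩⟩
    -- Pairing with `b p` evaluates both factors at the same point, where the antisymmetric tensor
    -- vanishes.
    have h0 : ∀ p, ⟪b p, S f ⊗ₜ[ℂ] g' - S g ⊗ₜ[ℂ] f'⟫_ℂ = 0 := by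
      intro p
      simp only [hb, inner_sub_right, TensorProduct.inner_tmul, kerFun_inner, hS,
        inner_smul_right, hf, hg]
      simp
      ring
    have h := inner_eq_zero_of_gram_eq hgram (denseRange_linearCombination_kerFun H) hy hle h0
    rw [inner_sub_right, TensorProduct.inner_tmul, TensorProduct.inner_tmul, kerFun_inner,
      kerFun_inner, hf, hg] at h
    simpa [sub_eq_zero] using h
  have h := hcomm (kerFun Hs₁ x (1 : ℂ)) (kerFun Hs₁ w (1 : ℂ))
  have hconj := conj_kernel hs₁
  rw [hSk, hSk, hY, inner_kerFun, inner_kerFun, mulOp_kerFun_apply h₁, mulOp_kerFun_apply h₁,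
    kerFun_apply_quasiscalar hs₁, kerFun_apply_quasiscalar hs₁, inner_smul_left, inner_smul_left,
    hconj, hconj, smul_eq_mul, mul_one, smul_eq_mul, mul_one] at h
  exact mul_left_cancel₀ (mul_ne_zero hwx hw) (by linear_combination h)

end Factorization

/-! ### Analyticity of bounded multipliers -/

section Analyticity

open scoped ComplexConjugate
open RKHS

variable {n : ℕ} {Ω : Set (EuclideanSpace ℂ (Fin n))} {E H : Type*} [NormedAddCommGroup E]
  [InnerProductSpace ℂ E] [CompleteSpace E] [NormedAddCommGroup H] [InnerProductSpace ℂ H]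
  [CompleteSpace H] [RKHS ℂ H Ω E] {k : Ω → Ω → ℂ}

theorem IsAnalytic.mul {f g : Ω → ℂ} (hf : IsAnalytic f) (hg : IsAnalytic g) :
    IsAnalytic fun z => f z * g z := by
  obtain ⟨f', hf', hff⟩ := hf
  obtain ⟨g', hg', hgg⟩ := hg
  exact ⟨f' * g', hf'.mul hg', fun z => by simp [hff, hgg]⟩

/-- A bounded operator-valued function that multiplies a space of functions with a quasiscalar
kernel, analytic in the first variable and nonvanishing on the diagonal, is analytic. -/
theorem IsMultiplier.isAnalytic (hΩ : IsOpen Ω) (hk : kernel H = quasiscalar E k)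
    (hherm : ∀ x y, conj (k x y) = k y x) (han : ∀ w, IsAnalytic fun z => k z w)
    (hne : ∀ w, k w w ≠ 0) {φ : Ω → E →L[ℂ] E} (hφ : IsMultiplier H H φ) {C : ℝ}
    (hC : ∀ z, ‖φ z‖ ≤ C) : IsAnalytic φ := by
  classical
  set g : EuclideanSpace ℂ (Fin n) → E →L[ℂ] E := fun p => if h : p ∈ Ω then φ ⟨p, h⟩ else 0
    with hg
  have hgφ : ∀ z : Ω, g z = φ z := fun z => by simp [hg]
  refine ⟨g, analyticOnNhd_of_lineDifferentiable hΩ (M := C) (fun y hy => ?_) fun y hy d => ?_, hgφ⟩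
  · simpa [hg, hy] using hC ⟨y, hy⟩
  set z : Ω := ⟨y, hy⟩ with hz
  have hline : Continuous fun ζ : ℂ => y + ζ • d := by fun_prop
  obtain ⟨R, hR, hRΩ⟩ := Metric.isOpen_iff.1 (hΩ.preimage hline) 0 (by simpa using hy)
  set c : ℂ → Ω := fun ζ => if h : y + ζ • d ∈ Ω then ⟨y + ζ • d, h⟩ else z with hcdef
  have hcval : ∀ ζ ∈ ball (0 : ℂ) R, (c ζ : EuclideanSpace ℂ (Fin n)) = y + ζ • d := by
    intro ζ hζ
    have : y + ζ • d ∈ Ω := hRΩ hζ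
    simp [hcdef, this]
  have hc : ∀ w, DifferentiableOn ℂ (fun ζ => k (c ζ) w) (ball 0 R) := by
    intro w
    obtain ⟨κ, hκ, hκk⟩ := han w
    have h1 : DifferentiableOn ℂ (fun ζ : ℂ => κ (y + ζ • d)) (ball 0 R) :=
      hκ.differentiableOn.comp (by fun_prop) fun ζ hζ => hRΩ hζ
    refine h1.congr fun ζ hζ => ?_
    simpa [hcval ζ hζ] using (hκk (c ζ)).symm
  obtain ⟨r, hr, hhol⟩ := exists_differentiableOn_comp hk hherm hR hc
  have hc0 : c 0 = z := Subtype.ext (by rw [hcval 0 (mem_ball_self hR)]; simp [hz])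
  have hnear : ∀ᶠ ζ in 𝓝 (0 : ℂ), k (c ζ) z ≠ 0 :=
    ((hc z).continuousOn.continuousAt (ball_mem_nhds 0 hR)).eventually_ne
      (by rw [hc0]; exact hne z)
  obtain ⟨s, hs, hsk⟩ := Metric.eventually_nhds_iff_ball.1 hnear
  have hφc : DifferentiableAt ℂ (fun ζ => φ (c ζ)) 0 := by
    set t := min (min r R) s with ht
    have ht0 : 0 < t := lt_min (lt_min hr hR) hs
    have htr : ball (0 : ℂ) t ⊆ ball 0 r :=
      ball_subset_ball ((min_le_left _ _).trans (min_le_left _ _))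
    have htR : ball (0 : ℂ) t ⊆ ball 0 R :=
      ball_subset_ball ((min_le_left _ _).trans (min_le_right _ _))
    have hts : ball (0 : ℂ) t ⊆ ball 0 s := ball_subset_ball (min_le_right _ _)
    have hC0 : 0 ≤ C := (norm_nonneg _).trans (hC z)
    refine differentiableAt_of_norming (r := t) (M := C)
      (T := fun v : closedBall (0 : E) 1 => ContinuousLinearMap.apply ℂ E (v : E)) ?_ ht0 hC0 ?_ ?_
    · intro A D hD hA
      refine ContinuousLinearMap.opNorm_le_of_unit_norm hD fun v hv => ?_
      exact hA ⟨v, by simp [hv]⟩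
    · intro v
      -- Near `z`, `φ v` is the function `M_φ K_z v` of the space divided by the nonvanishing `k(·,
      -- z)`.
      have h1 := ((hc z).mono htR).inv (fun ζ hζ => hsk ζ (hts hζ)) |>.smul
        ((hhol (mulOp hφ (kerFun H z (v : E)))).mono htr)
      refine h1.congr fun ζ hζ => ?_
      simp [mulOp_kerFun_apply hk, smul_smul, inv_mul_cancel₀ (hsk ζ (hts hζ))]
    · intro v ζ _
      have hv : ‖(v : E)‖ ≤ 1 := mem_closedBall_zero_iff.1 v.2
      calc ‖φ (c ζ) (v : E)‖ ≤ ‖φ (c ζ)‖ * ‖(v : E)‖ := (φ (c ζ)).le_opNorm _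
        _ ≤ C * 1 := by gcongr; exact hC _
        _ = C := mul_one C
  refine DifferentiableAt.congr_of_eventuallyEq hφc ?_
  filter_upwards [ball_mem_nhds (0 : ℂ) hR] with ζ hζ
  rw [← hgφ, hcval ζ hζ]

end Analyticity

end KernelMultiplier

/-! ### Assembly of the theorem -/

theorem mainTheorem6 {n : ℕ} {Ω : Set (EuclideanSpace ℂ (Fin n))}
    (hΩ_open : IsOpen Ω) (hΩ_conn : IsConnected Ω)
    {E₁ : Type*} [NormedAddCommGroup E₁] [InnerProductSpace ℂ E₁] [CompleteSpace E₁]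
    -- the scalar kernels, analytic in the first variable
    (k₁ k₂ : Ω → Ω → ℂ)
    (hk₁ : ∀ w : Ω, KernelMultiplier.IsAnalytic fun z => k₁ z w)
    (hk₂ : ∀ w : Ω, KernelMultiplier.IsAnalytic fun z => k₂ z w)
    -- the reproducing kernel Hilbert spaces with kernels `k₁`, `k₂`, `K₁ = k₁ I` and `K = K₁ k₂`
    {Hk₁ : Type*} [NormedAddCommGroup Hk₁] [InnerProductSpace ℂ Hk₁] [CompleteSpace Hk₁]
    [RKHS ℂ Hk₁ Ω ℂ] (hHk₁ : RKHS.kernel Hk₁ = KernelMultiplier.quasiscalar ℂ k₁)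
    {Hk₂ : Type*} [NormedAddCommGroup Hk₂] [InnerProductSpace ℂ Hk₂] [CompleteSpace Hk₂]
    [RKHS ℂ Hk₂ Ω ℂ] (hHk₂ : RKHS.kernel Hk₂ = KernelMultiplier.quasiscalar ℂ k₂)
    {HK₁ : Type*} [NormedAddCommGroup HK₁] [InnerProductSpace ℂ HK₁] [CompleteSpace HK₁]
    [RKHS ℂ HK₁ Ω E₁] (hHK₁ : RKHS.kernel HK₁ = KernelMultiplier.quasiscalar E₁ k₁)
    {HK : Type*} [NormedAddCommGroup HK] [InnerProductSpace ℂ HK] [CompleteSpace HK]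
    [RKHS ℂ HK Ω E₁]
    (hHK : RKHS.kernel HK = Matrix.of fun z w => k₂ z w • KernelMultiplier.quasiscalar E₁ k₁ z w)
    -- the multipliers of `HK₁` are the bounded analytic functions, with the supremum norm
    (h_mult : ∀ φ : Ω → E₁ →L[ℂ] E₁, KernelMultiplier.IsMultiplier HK₁ HK₁ φ ↔
      KernelMultiplier.IsAnalytic φ ∧ ∃ C : ℝ, ∀ z, ‖φ z‖ ≤ C)
    (h_norm : ∀ (φ : Ω → E₁ →L[ℂ] E₁) (h : KernelMultiplier.IsMultiplier HK₁ HK₁ φ),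
      IsLUB (Set.range fun z => ‖φ z‖) ‖KernelMultiplier.mulOp h‖)
    -- the intersection of `Hk₁` and `Hk₂` is dense in `Hk₁`
    (h_dense : Dense {f : Hk₁ | ∃ g : Hk₂, ∀ z, g z = f z})
    -- an isometric multiplier of `HK`
    (φ : Ω → E₁ →L[ℂ] E₁) (hφ : KernelMultiplier.IsMultiplier HK HK φ)
    (hφ_iso : Isometry (KernelMultiplier.mulOp hφ)) :
    ∀ z : Ω, ∃ V : E₁ →ₗᵢ[ℂ] E₁, ∀ w : Ω,
      KernelMultiplier.KernelChain k₁ z w → φ w = V.toContinuousLinearMap := by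
  have hK : RKHS.kernel HK = KernelMultiplier.quasiscalar E₁ fun z w => k₂ z w * k₁ z w := by
    rw [hHK]
    ext z w v
    simp [KernelMultiplier.quasiscalar, smul_smul]
  intro z
  -- If `E₁ = 0`, the identity has norm 0 and the norm formula says nothing about the diagonal of
  -- `k₁`.
  rcases subsingleton_or_nontrivial E₁ with _ | _
  · exact ⟨LinearIsometry.id, fun w _ => ContinuousLinearMap.ext fun v => Subsingleton.elim _ _⟩
  have hne₁ := KernelMultiplier.kernel_self_ne_zero_of_isLUB hHK₁ h_norm
  have hne : ∀ w, k₂ w w * k₁ w w ≠ 0 := fun w => mul_ne_zero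
    (KernelMultiplier.kernel_self_ne_zero_of_dense hHk₁ hHk₂ h_dense (hne₁ w)) (hne₁ w)
  have hherm : ∀ x y, (starRingEnd ℂ) (k₂ x y * k₁ x y) = k₂ y x * k₁ y x := fun x y => by
    rw [map_mul, KernelMultiplier.conj_kernel hHk₁, KernelMultiplier.conj_kernel hHk₂]
  have hbound : ∀ w, ‖φ w‖ ≤ 1 := fun w =>
    KernelMultiplier.norm_le_one_of_isometry hK hφ hφ_iso (hne w)
  have hφ₁ : KernelMultiplier.IsMultiplier HK₁ HK₁ φ := (h_mult φ).2
    ⟨hφ.isAnalytic hΩ_open hK hherm (fun w => (hk₂ w).mul (hk₁ w)) hne hbound, 1, hbound⟩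
  have hT : ‖KernelMultiplier.mulOp hφ₁‖ ≤ 1 := (h_norm φ hφ₁).2 (by
    rintro _ ⟨w, rfl⟩
    exact hbound w)
  have hconst : ∀ w x, k₁ w x ≠ 0 → φ x = φ w := fun w x =>
    KernelMultiplier.eq_of_kernel_ne_zero hHk₁ hHk₂ hHK₁ hK h_dense hφ hφ_iso hφ₁ hT (hne₁ w)
  refine ⟨⟨(φ z : E₁ →ₗ[ℂ] E₁), KernelMultiplier.norm_apply_of_forall_eq hK hφ hφ_iso (hne z)
    fun x hx => (hconst x z (right_ne_zero_of_mul hx)).symm⟩, fun w hzw => ?_⟩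
  have hw : φ w = φ z := by
    induction hzw with
    | refl => rfl
    | tail _ h ih => rw [hconst _ _ h, ih]
  rw [hw]
  rfl
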